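/- For $k \ge 0$, a mesh pattern of length $k$ is a pair $(\tau, R)$, where $\tau$ is a permutation of $\{1, \dots, k\}$ and $R \subseteq \{0, \dots, k\} \times \{0, \dots, k\}$. Let $\pi$ be a permutation of $\{1, \dots, n\}$. An occurrence of $(\tau, R)$ in $\pi$ is a sequence of positions $1 \le c_1 < \dots < c_k \le n$ such that the word $\pi(c_1) \cdots \pi(c_k)$ is in the same relative order as $\tau(1) \cdots \tau(k)$ and such that, if $v_1 < \dots < v_k$ are the values $\pi(c_1), \dots, \pi(c_k)$ in increasing order and $c_0 = v_0 = 0$, $c_{k+1} = v_{k+1} = n+1$, then for every $(a, b) \in R$ there is no $m \in \{1, \dots, n\}$ with $c_a < m < c_{a+1}$ and $v_b < \pi(m) < v_{b+1}$. The permutation $\pi$ avoids a pattern if the pattern has no occurrence in $\pi$, and $S_n(p)$ is the set of permutations of $\{1, \dots, n\}$ that avoid $p$. Two mesh patterns $p, q$ of the same length are Wilf-equivalent if $|S_n(p)| = |S_n(q)|$ for all $n \ge 0$. A Wilf-class is a maximal set of pairwise Wilf-equivalent mesh patterns of the same length. There are $1024$ mesh patterns of length $2$, and they fall into at most $56$ Wilf-classes.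 -/

import Mathlib

/-- A mesh pattern of length `k`: a pair `(τ, R)` of a permutation `τ ∈ S_k` and a set `R` of shaded
boxes, `R ⊆ {0, …, k} × {0, …, k}`. Permutations act on `Fin k = {0, …, k - 1}`, so the `i`-th
letter (`1 ≤ i ≤ k`) is `τ (i - 1) + 1`. -/
abbrev MeshPattern (k : ℕ) : Type :=
  Equiv.Perm (Fin k) × Finset (Fin (k + 1) × Fin (k + 1))

namespace MeshPattern

/-- The point `(m, π m)` of the diagram of `π` lies in the region that corresponds to the box
`(a, b)`, for the choice `c` of positions for the letters of `τ`: exactly the first `a` of the chosen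
points lie strictly to its left and the other ones strictly to its right, and exactly the `b`
lowest chosen points lie strictly below it and the other ones strictly above it. The chosen point
that plays the role of the `j`-th smallest letter of `τ` is at the position `c (τ⁻¹ j)`. -/
def InBox {k n : ℕ} (τ : Equiv.Perm (Fin k)) (π : Equiv.Perm (Fin n)) (c : Fin k → Fin n)
    (a b : Fin (k + 1)) (m : Fin n) : Prop :=
  (∀ i : Fin k, ((i : ℕ) < (a : ℕ) → c i < m) ∧ ((a : ℕ) ≤ (i : ℕ) → m < c i)) ∧
  (∀ j : Fin k, ((j : ℕ) < (b : ℕ) → π (c (τ.symm j)) < π m) ∧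
    ((b : ℕ) ≤ (j : ℕ) → π m < π (c (τ.symm j))))

/-- The subsequence of `π` at the positions `c 0 < c 1 < ⋯` is an occurrence of `p = (τ, R)`: its
letters are in the same relative order as those of `τ`, and no point of `π` lies in a region
that corresponds to a shaded box. -/
def IsOccurrence {k n : ℕ} (p : MeshPattern k) (π : Equiv.Perm (Fin n)) (c : Fin k → Fin n) :
    Prop :=
  StrictMono c ∧ (∀ i j : Fin k, π (c i) < π (c j) ↔ p.1 i < p.1 j) ∧
    ∀ a b : Fin (k + 1), (a, b) ∈ p.2 → ∀ m : Fin n, ¬ InBox p.1 π c a b m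

/-- `π` avoids `p` if `p` has no occurrence in `π`. -/
def Avoids {k n : ℕ} (π : Equiv.Perm (Fin n)) (p : MeshPattern k) : Prop :=
  ¬ ∃ c : Fin k → Fin n, IsOccurrence p π c

/-- `S_n(p)`, the set of the permutations of length `n` that avoid `p`. -/
def avoiders {k : ℕ} (p : MeshPattern k) (n : ℕ) : Set (Equiv.Perm (Fin n)) :=
  {π | Avoids π p}

/-- Wilf-equivalence: `|S_n(p)| = |S_n(q)|` for all `n`. -/
def WilfEquiv {k : ℕ} (p q : MeshPattern k) : Prop :=
  ∀ n : ℕ, (avoiders p n).ncard = (avoiders q n).ncard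

/-- A Wilf-subclass: a set of pairwise Wilf-equivalent patterns of the same length. -/
def IsWilfSubclass {k : ℕ} (A : Set (MeshPattern k)) : Prop :=
  ∀ p ∈ A, ∀ q ∈ A, WilfEquiv p q

/-- A Wilf-class: a Wilf-subclass that is maximal under inclusion. -/
def IsWilfClass {k : ℕ} (A : Set (MeshPattern k)) : Prop :=
  Maximal IsWilfSubclass A

end MeshPattern

namespace MeshPattern

open Equiv

/-! Reading permutations backwards turns `21` into `12` (`ncard_avoiders_swap`), so only the 512
shadings of `12` matter. A shading is coded by a number below 512 whose bit `3 * a + b` stands for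
the box `(a, b)`.

Four kinds of elementary equivalence connect these shadings (`Step.sameCount`). Inverse and half
turn permute the boxes. Some boxes may be shaded without changing the set of avoiders, because an
extremal choice of occurrence leaves them empty (`Contains.shade`). Two bijections handle a fully
shaded top row (`shiftUp`) and a fully shaded left column (`reverseAboveFirst`). Four remaining
pairs are settled by counting: the avoiders satisfy equal recurrences, obtained by appending a last
letter or, for shading 186, also by contracting a succession.

The graph of these equivalences is covered by an explicit forest, stored in `parentTable`. A finite
computation checks its edges (`step_parent`), that every vertex reaches a root
(`iterate_parent_mem_roots`) and that there are 56 roots (`card_roots`). Each Wilf-class therefore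
contains a pattern counted by some root. Distinct roots are not claimed to be inequivalent, so this
yields only an upper bound. -/

/-- The index of the one of the three strips cut out by the lines `x < y` that contains `m`. -/
def zone {n : ℕ} (x y m : Fin n) : ℕ := if m < x then 0 else if m < y then 1 else 2

/-- The points of `π` at the positions `i < j` form an occurrence of `12` in which the boxes
selected by `s` are empty. -/
def Occ {n : ℕ} (s : ℕ → ℕ → Bool) (π : Perm (Fin n)) (i j : Fin n) : Prop :=
  i < j ∧ π i < π j ∧ ∀ m, m ≠ i → m ≠ j → s (zone i j m) (zone (π i) (π j) (π m)) = false

/-- `π` contains the pattern `12` with the shading `s`. -/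
def Contains {n : ℕ} (s : ℕ → ℕ → Bool) (π : Perm (Fin n)) : Prop :=
  ∃ i j, Occ s π i j

theorem zone_lt {n : ℕ} (x y m : Fin n) : zone x y m < 3 := by
  unfold zone; split_ifs <;> decide

theorem Occ.mono {n : ℕ} {s t : ℕ → ℕ → Bool} {π : Perm (Fin n)} {i j : Fin n}
    (hst : ∀ a < 3, ∀ b < 3, s a b = true → t a b = true) (h : Occ t π i j) : Occ s π i j := by
  refine ⟨h.1, h.2.1, fun m hi hj => ?_⟩
  have h1 := h.2.2 m hi hj
  have h2 := hst _ (zone_lt i j m) _ (zone_lt (π i) (π j) (π m))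
  grind

theorem Contains.mono {n : ℕ} {s t : ℕ → ℕ → Bool} {π : Perm (Fin n)}
    (hst : ∀ a < 3, ∀ b < 3, s a b = true → t a b = true) : Contains t π → Contains s π :=
  fun ⟨i, j, h⟩ => ⟨i, j, h.mono hst⟩

/-! ### Boxes that can be shaded without changing the avoiders -/

/-- If the box `(1, 1)` of an occurrence is not empty, then its leftmost point can replace the
first point of the occurrence. -/
theorem Occ.replace_one_one {n : ℕ} {s : ℕ → ℕ → Bool} {π : Perm (Fin n)} {i j m : Fin n}
    (h00 : s 0 0 = false) (h10 : s 1 0 = false) (h02 : s 0 2 = true → s 1 2 = true)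
    (h20 : s 2 0 = true → s 2 1 = true) (h : Occ s π i j)
    (hm : (i < m ∧ m < j) ∧ π i < π m ∧ π m < π j)
    (hmin : ∀ x, (i < x ∧ x < j) ∧ π i < π x ∧ π x < π j → m ≤ x) : Occ s π m j := by
  refine ⟨hm.1.2, hm.2.2, fun x hxm hxj => ?_⟩
  have hx := h.2.2 x
  replace hmin := hmin x
  have h1 : π x ≠ π m := fun e => hxm (π.injective e)
  have h2 : π x ≠ π j := fun e => hxj (π.injective e)
  have h3 : x ≠ i → π x ≠ π i := fun e e' => e (π.injective e')
  -- The old first point `i` now lies in box `(0, 0)`. Box `(1, 0)` may gain points of the old `(1,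
  -- 1)`, box `(0, 2)` absorbs part of the old `(1, 2)`, and `(2, 0)` part of `(2, 1)`; the four
  -- hypotheses cover exactly these changes.
  grind [zone]

/-- If the box `(0, 0)` of an occurrence is not empty, then its lowest point can replace the
first point of the occurrence. -/
theorem Occ.replace_zero_zero {n : ℕ} {s : ℕ → ℕ → Bool} {π : Perm (Fin n)} {i j m : Fin n}
    (h11 : s 1 1 = false) (h01 : s 0 1 = false) (h12 : s 1 2 = true → s 0 2 = true)
    (h21 : s 2 1 = true → s 2 0 = true) (h : Occ s π i j)
    (hm : m < i ∧ π m < π i)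
    (hmin : ∀ x, x < i ∧ π x < π i → π m ≤ π x) : Occ s π m j := by
  refine ⟨hm.1.trans h.1, hm.2.trans h.2.1, fun x hxm hxj => ?_⟩
  have hx := h.2.2 x
  replace hmin := hmin x
  have hij := h.1
  have hpij := h.2.1
  have h1 : π x ≠ π m := fun e => hxm (π.injective e)
  have h2 : π x ≠ π j := fun e => hxj (π.injective e)
  have h3 : x ≠ i → π x ≠ π i := fun e e' => e (π.injective e')
  grind [zone]

/-- If the box `(0, 1)` of an occurrence is not empty, then its leftmost point can replace the
first point of the occurrence, if `(1, 1)` is not shaded. -/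
theorem Occ.replace_zero_one_leftmost {n : ℕ} {s : ℕ → ℕ → Bool} {π : Perm (Fin n)}
    {i j m : Fin n} (h10 : s 1 0 = false) (h11 : s 1 1 = false)
    (h12 : s 1 2 = true → s 0 2 = true) (h20 : s 2 0 = true → s 2 1 = true) (h : Occ s π i j)
    (hm : m < i ∧ π i < π m ∧ π m < π j)
    (hmin : ∀ x, x < i ∧ π i < π x ∧ π x < π j → m ≤ x) : Occ s π m j := by
  refine ⟨hm.1.trans h.1, hm.2.2, fun x hxm hxj => ?_⟩
  have hx := h.2.2 x
  replace hmin := hmin x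
  have hij := h.1
  have hpij := h.2.1
  have h1 : π x ≠ π m := fun e => hxm (π.injective e)
  have h2 : π x ≠ π j := fun e => hxj (π.injective e)
  have h3 : x ≠ i → π x ≠ π i := fun e e' => e (π.injective e')
  grind [zone]

/-- If the box `(0, 1)` of an occurrence is not empty, then its highest point can replace the
first point of the occurrence, if `(0, 0)` is not shaded. -/
theorem Occ.replace_zero_one_highest {n : ℕ} {s : ℕ → ℕ → Bool} {π : Perm (Fin n)}
    {i j m : Fin n} (h10 : s 1 0 = false) (h00 : s 0 0 = false)
    (h12 : s 1 2 = true → s 0 2 = true) (h20 : s 2 0 = true → s 2 1 = true) (h : Occ s π i j)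
    (hm : m < i ∧ π i < π m ∧ π m < π j)
    (hmax : ∀ x, x < i ∧ π i < π x ∧ π x < π j → π x ≤ π m) : Occ s π m j := by
  refine ⟨hm.1.trans h.1, hm.2.2, fun x hxm hxj => ?_⟩
  have hx := h.2.2 x
  replace hmax := hmax x
  have hij := h.1
  have hpij := h.2.1
  have h1 : π x ≠ π m := fun e => hxm (π.injective e)
  have h2 : π x ≠ π j := fun e => hxj (π.injective e)
  have h3 : x ≠ i → π x ≠ π i := fun e e' => e (π.injective e')
  grind [zone]

/-- In a finite type, a point of a nonempty predicate with the smallest value of a key. -/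
theorem exists_minimal_key {n : ℕ} {β : Type*} [LinearOrder β] {P : Fin n → Prop}
    (f : Fin n → β) (h : ∃ x, P x) : ∃ m, P m ∧ ∀ x, P x → f m ≤ f x := by
  classical
  obtain ⟨x, hx⟩ := h
  obtain ⟨m, hm, hmin⟩ := Finset.exists_min_image (Finset.univ.filter P) f ⟨x, by simpa using hx⟩
  exact ⟨m, by simpa using hm, fun y hy => hmin y (by simpa using hy)⟩

/-- If the first point of every occurrence of `s` whose box `(a, b)` is not empty can be replaced
by one with a smaller key, then the box `(a, b)` may be shaded. -/
theorem Contains.shade {n : ℕ} {β : Type*} [LinearOrder β] {s t : ℕ → ℕ → Bool}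
    {π : Perm (Fin n)} {a b : ℕ} (f : Fin n → β)
    (hst : ∀ x < 3, ∀ y < 3, t x y = true → s x y = true ∨ x = a ∧ y = b)
    (key : ∀ i j, Occ s π i j →
      (∃ x, (x ≠ i ∧ x ≠ j) ∧ zone i j x = a ∧ zone (π i) (π j) (π x) = b) →
      ∃ m, Occ s π m j ∧ f m < f i)
    (h : Contains s π) : Contains t π := by
  obtain ⟨i, ⟨j, hij⟩, hmin⟩ := exists_minimal_key f h
  refine ⟨i, j, hij.1, hij.2.1, fun x hxi hxj => ?_⟩
  by_contra hx
  rcases hst _ (zone_lt i j x) _ (zone_lt (π i) (π j) (π x)) (by simpa using hx) with h' | h'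
  · simp [hij.2.2 x hxi hxj] at h'
  · obtain ⟨m, hm, hlt⟩ := key i j hij ⟨x, ⟨hxi, hxj⟩, h'⟩
    exact absurd (hmin m ⟨j, hm⟩) (not_le.2 hlt)

/-- The replacement moves the first point to the right, so an occurrence with rightmost first point
has box `(1, 1)` empty; hence the dual order as key. -/
theorem Contains.shade_one_one {n : ℕ} {s t : ℕ → ℕ → Bool} {π : Perm (Fin n)}
    (h00 : s 0 0 = false) (h10 : s 1 0 = false) (h02 : s 0 2 = true → s 1 2 = true)
    (h20 : s 2 0 = true → s 2 1 = true)
    (hst : ∀ x < 3, ∀ y < 3, t x y = true → s x y = true ∨ x = 1 ∧ y = 1)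
    (h : Contains s π) : Contains t π := by
  refine h.shade OrderDual.toDual hst fun i j hij ⟨x, hx⟩ => ?_
  obtain ⟨m, hm, hmin⟩ := exists_minimal_key
    (P := fun x => (i < x ∧ x < j) ∧ π i < π x ∧ π x < π j) id
    ⟨x, by have := π.injective.ne hx.1.1; grind [zone]⟩
  exact ⟨m, hij.replace_one_one h00 h10 h02 h20 hm hmin, hm.1.1⟩

theorem Contains.shade_zero_zero {n : ℕ} {s t : ℕ → ℕ → Bool} {π : Perm (Fin n)}
    (h11 : s 1 1 = false) (h01 : s 0 1 = false) (h12 : s 1 2 = true → s 0 2 = true)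
    (h21 : s 2 1 = true → s 2 0 = true)
    (hst : ∀ x < 3, ∀ y < 3, t x y = true → s x y = true ∨ x = 0 ∧ y = 0)
    (h : Contains s π) : Contains t π := by
  refine h.shade id hst fun i j hij ⟨x, hx⟩ => ?_
  obtain ⟨m, hm, hmin⟩ := exists_minimal_key (P := fun x => x < i ∧ π x < π i) π
    ⟨x, by grind [zone]⟩
  exact ⟨m, hij.replace_zero_zero h11 h01 h12 h21 hm hmin, hm.1⟩

theorem Contains.shade_zero_one {n : ℕ} {s t : ℕ → ℕ → Bool} {π : Perm (Fin n)}
    (h10 : s 1 0 = false) (h : s 1 1 = false ∨ s 0 0 = false)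
    (h12 : s 1 2 = true → s 0 2 = true) (h20 : s 2 0 = true → s 2 1 = true)
    (hst : ∀ x < 3, ∀ y < 3, t x y = true → s x y = true ∨ x = 0 ∧ y = 1)
    (hs : Contains s π) : Contains t π := by
  refine hs.shade id hst fun i j hij ⟨x, hx⟩ => ?_
  have hne : ∃ x, x < i ∧ π i < π x ∧ π x < π j :=
    ⟨x, by have := π.injective.ne hx.1.1; grind [zone]⟩
  -- Both replacements move the first point to the left, so position serves as the key in either
  -- case.
  rcases h with h | h
  · obtain ⟨m, hm, hmin⟩ := exists_minimal_key id hne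
    exact ⟨m, hij.replace_zero_one_leftmost h10 h h12 h20 hm hmin, hm.1⟩
  · obtain ⟨m, hm, hmin⟩ := exists_minimal_key (fun x => OrderDual.toDual (π x)) hne
    exact ⟨m, hij.replace_zero_one_highest h10 h h12 h20 hm hmin, hm.1⟩

/-- The boxes `(0, 0)`, `(0, 1)`, `(1, 2)`, `(2, 2)` may be shaded: choose the first point leftmost
and then the second point highest. -/
theorem Contains.shade_of_unshaded {n : ℕ} {s t : ℕ → ℕ → Bool} {π : Perm (Fin n)}
    (ht : ∀ x < 3, ∀ y < 3, t x y = true → x = 0 ∧ y < 2 ∨ 0 < x ∧ y = 2)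
    (hs : Contains s π) : Contains t π := by
  obtain ⟨i, ⟨j, hj⟩, hi⟩ := exists_minimal_key (P := fun i => ∃ j, i < j ∧ π i < π j) id
    (hs.imp fun i ⟨j, h⟩ => ⟨j, h.1, h.2.1⟩)
  obtain ⟨j, hj, hmax⟩ := exists_minimal_key (P := fun j => i < j ∧ π i < π j)
    (fun j => OrderDual.toDual (π j)) ⟨j, hj⟩
  refine ⟨i, j, hj.1, hj.2, fun x hxi hxj => ?_⟩
  have h1 := ht _ (zone_lt i j x) _ (zone_lt (π i) (π j) (π x))
  have h2 := hi x
  have h3 : i < x ∧ π i < π x → π x ≤ π j := fun h => hmax x h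
  have h4 := π.injective.ne hxi
  have h5 := π.injective.ne hxj
  have h6 : x < j ∧ π x < π j → i ≤ x := fun h => hi x ⟨j, h⟩
  grind [zone]

/-- If `(0, 2)` is shaded then the boxes in row `1` and column `0` may be shaded: the first letter
and the next larger value form an occurrence. -/
theorem Contains.shade_of_zero_two {n : ℕ} {s t : ℕ → ℕ → Bool} {π : Perm (Fin n)}
    (h02 : s 0 2 = true) (ht : ∀ x < 3, ∀ y < 3, t x y = true → x = 0 ∨ y = 1)
    (hs : Contains s π) : Contains t π := by
  obtain ⟨i, j, hij⟩ := hs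
  obtain ⟨k, -, hk⟩ := exists_minimal_key (P := fun _ => True) (id : Fin n → Fin n) ⟨i, trivial⟩
  -- A first letter above `π j` would be a point of the shaded box `(0, 2)`.
  have hkj : π k < π j := by
    have h1 := hij.2.2 k
    have h2 := hk i trivial
    have h3 := hij.1
    have h4 := hij.2.1
    have h5 : k ≠ j → π k ≠ π j := fun e e' => e (π.injective e')
    grind [zone]
  obtain ⟨l, hl, hmin⟩ := exists_minimal_key (P := fun l => π k < π l) π ⟨j, hkj⟩
  have hkl : k < l := lt_of_le_of_ne (hk l trivial) (by rintro rfl; exact lt_irrefl _ hl)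
  refine ⟨k, l, hkl, hl, fun x hxi hxj => ?_⟩
  have h1 := ht _ (zone_lt k l x) _ (zone_lt (π k) (π l) (π x))
  have h2 := hmin x
  have h3 := hk x trivial
  have h4 := π.injective.ne hxi
  have h5 := π.injective.ne hxj
  grind [zone]

/-! ### Equality of counts and the symmetries of the diagram -/

/-- The number of permutations of length `n` that avoid `12` with the shading `s`. -/
noncomputable def numAvoiding (s : ℕ → ℕ → Bool) (n : ℕ) : ℕ :=
  {π : Perm (Fin n) | ¬ Contains s π}.ncard

/-- Two shadings of `12` give Wilf-equivalent patterns. -/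
def SameCount (s t : ℕ → ℕ → Bool) : Prop := ∀ n, numAvoiding s n = numAvoiding t n

theorem numAvoiding_le {n : ℕ} {s t : ℕ → ℕ → Bool}
    (h : ∀ π : Perm (Fin n), Contains t π → Contains s π) : numAvoiding s n ≤ numAvoiding t n :=
  Set.ncard_le_ncard fun π hπ ht => hπ (h π ht)

theorem numAvoiding_zero (s : ℕ → ℕ → Bool) : numAvoiding s 0 = 1 := by
  have : {π : Perm (Fin 0) | ¬ Contains s π} = {1} := by
    ext π
    simp [Contains, Subsingleton.elim π 1]
  rw [numAvoiding, this, Set.ncard_singleton]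

theorem SameCount.of_contains {s t : ℕ → ℕ → Bool}
    (h : ∀ (n : ℕ) (π : Perm (Fin n)), Contains s π → Contains t π)
    (h' : ∀ (n : ℕ) (π : Perm (Fin n)), Contains t π → Contains s π) : SameCount s t :=
  fun n => (numAvoiding_le (h' n)).antisymm (numAvoiding_le (h n))

theorem SameCount.congr {s t : ℕ → ℕ → Bool} (h : ∀ a < 3, ∀ b < 3, s a b = t a b) :
    SameCount s t :=
  .of_contains (fun _ _ => .mono fun a ha b hb => by simp [h a ha b hb])
    (fun _ _ => .mono fun a ha b hb => by simp [h a ha b hb])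

/-- Shadings that lie between two shadings for which containment is equivalent. -/
theorem SameCount.of_between {s t u : ℕ → ℕ → Bool}
    (hst : ∀ a < 3, ∀ b < 3, s a b = true → t a b = true)
    (htu : ∀ a < 3, ∀ b < 3, t a b = true → u a b = true)
    (h : ∀ (n : ℕ) (π : Perm (Fin n)), Contains s π → Contains u π) : SameCount s t :=
  .of_contains (fun n π hs => (h n π hs).mono htu) (fun _ _ => .mono hst)

theorem numAvoiding_eq_of_equiv {n : ℕ} {s t : ℕ → ℕ → Bool} (e : Perm (Fin n) ≃ Perm (Fin n))
    (h : ∀ π, Contains s π → Contains t (e π)) (h' : ∀ π, Contains t (e π) → Contains s π) :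
    numAvoiding s n = numAvoiding t n := by
  refine Set.ncard_congr (fun π _ => e π) (fun π hπ ht => hπ (h' π ht))
    (fun π σ _ _ he => e.injective he) fun σ hσ => ⟨e.symm σ, fun hs => hσ ?_, by simp⟩
  simpa using h _ hs

theorem Contains.symm {n : ℕ} {s t : ℕ → ℕ → Bool} {π : Perm (Fin n)}
    (hst : ∀ a < 3, ∀ b < 3, t b a = s a b) : Contains s π → Contains t π.symm := by
  rintro ⟨i, j, hij, hπ, h⟩
  refine ⟨π i, π j, hπ, by simpa using hij, fun m hi hj => ?_⟩
  rw [hst _ (zone_lt _ _ _) _ (zone_lt _ _ _)]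
  simpa using h (π.symm m) (by grind) (by grind)

theorem SameCount.transpose {s t : ℕ → ℕ → Bool} (hst : ∀ a < 3, ∀ b < 3, t b a = s a b) :
    SameCount s t := fun _ =>
  numAvoiding_eq_of_equiv ⟨Equiv.symm, Equiv.symm, fun _ => rfl, fun _ => rfl⟩
    (fun _ h => h.symm hst) (fun _ h => h.symm fun a ha b hb => (hst b hb a ha).symm)

/-- The strips are half-open, so reflection matches them only away from the two boundary lines. -/
theorem zone_rev {n : ℕ} {x y m : Fin n} (hx : m ≠ x) (hy : m ≠ y) (hxy : x < y) :
    zone y.rev x.rev m.rev = 2 - zone x y m := by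
  simp only [zone, Fin.rev_lt_rev]
  grind

/-- The permutation `π` turned upside down and read from right to left. -/
def rotateHalf {n : ℕ} (π : Perm (Fin n)) : Perm (Fin n) :=
  (Fin.revPerm.trans π).trans Fin.revPerm

theorem rotateHalf_rotateHalf {n : ℕ} (π : Perm (Fin n)) : rotateHalf (rotateHalf π) = π := by
  ext; simp [rotateHalf]

theorem Contains.rotateHalf {n : ℕ} {s t : ℕ → ℕ → Bool} {π : Perm (Fin n)}
    (hst : ∀ a < 3, ∀ b < 3, t (2 - a) (2 - b) = s a b) :
    Contains s π → Contains t (rotateHalf π) := by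
  rintro ⟨i, j, hij, hπ, h⟩
  refine ⟨j.rev, i.rev, by simpa using hij, by simpa [MeshPattern.rotateHalf] using hπ,
    fun m hj hi => ?_⟩
  obtain ⟨m, rfl⟩ := Fin.rev_surjective m
  have hi : m ≠ i := fun e => hi (by rw [e])
  have hj : m ≠ j := fun e => hj (by rw [e])
  simp only [MeshPattern.rotateHalf, Equiv.trans_apply, Fin.revPerm_apply, Fin.rev_rev]
  rw [zone_rev hi hj hij, zone_rev (π.injective.ne hi) (π.injective.ne hj) hπ,
    hst _ (zone_lt _ _ _) _ (zone_lt _ _ _)]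
  exact h m hi hj

theorem SameCount.rotate {s t : ℕ → ℕ → Bool}
    (hst : ∀ a < 3, ∀ b < 3, t (2 - a) (2 - b) = s a b) : SameCount s t := fun _ =>
  numAvoiding_eq_of_equiv
    ⟨rotateHalf, rotateHalf, rotateHalf_rotateHalf, rotateHalf_rotateHalf⟩
    (fun π h => h.rotateHalf hst) fun π h => by
      have := h.rotateHalf (t := s) fun a ha b hb => by
        rw [← hst (2 - a) (by omega) (2 - b) (by omega)]
        congr 1 <;> omega
      simpa [rotateHalf_rotateHalf] using this

/-! ### The cyclic shift of values -/

/-- The permutation read from right to left, with `1` added to all values modulo `n`. -/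
def shiftUp {n : ℕ} : Perm (Fin n) ≃ Perm (Fin n) where
  toFun π := (Fin.revPerm.trans π).trans (finRotate n)
  invFun π := Fin.revPerm.trans (π.trans (finRotate n).symm)
  left_inv π := by
    ext x
    simp only [Equiv.trans_apply, Fin.revPerm_apply, Fin.rev_rev, symm_apply_apply]
  right_inv π := by
    ext x
    simp only [Equiv.trans_apply, Fin.revPerm_apply, Fin.rev_rev, apply_symm_apply]

theorem val_finRotate {n : ℕ} (x : Fin n) :
    (x.val + 1 < n ∧ (finRotate n x).val = x + 1) ∨ (x.val + 1 = n ∧ (finRotate n x).val = 0) := by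
  cases n with
  | zero => exact x.elim0
  | succ n =>
    rcases eq_or_ne x (Fin.last n) with rfl | h
    · right; simp only [finRotate_last, Fin.val_last, Fin.val_zero, and_self]
    · left
      have := Fin.val_lt_last h
      exact ⟨by omega, coe_finRotate_of_ne_last h⟩

theorem Contains.shiftUp {n : ℕ} {s t : ℕ → ℕ → Bool} {π : Perm (Fin n)}
    (hs : ∀ a < 3, s a 2 = true) (hst : ∀ a < 3, ∀ b < 3, t (2 - a) ((b + 1) % 3) = s a b) :
    Contains s π → Contains t (shiftUp π) := by
  rintro ⟨i, j, hij, hπ, h⟩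
  -- The shaded top row forces the second point to carry the largest value.
  have hmax : ∀ m, π m ≤ π j := by
    intro m
    have h1 := h m
    have h2 := hs _ (zone_lt i j m)
    grind [zone]
  have hj : (π j).val + 1 = n := by
    have := hmax (π.symm ⟨n - 1, by have := i.isLt; omega⟩)
    simp only [apply_symm_apply, Fin.le_def] at this
    omega
  have hj' := val_finRotate (π j)
  have hi' := val_finRotate (π i)
  refine ⟨j.rev, i.rev, by simpa using hij, ?_, fun m hmj hmi => ?_⟩
  · simp only [MeshPattern.shiftUp, Equiv.coe_fn_mk, Equiv.trans_apply, Fin.revPerm_apply,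
      Fin.rev_rev]
    rw [Fin.lt_def] at hπ ⊢
    omega
  · obtain ⟨m, rfl⟩ := Fin.rev_surjective m
    have hi : m ≠ i := fun e => hmi (by rw [e])
    have hj : m ≠ j := fun e => hmj (by rw [e])
    simp only [MeshPattern.shiftUp, Equiv.coe_fn_mk, Equiv.trans_apply, Fin.revPerm_apply,
      Fin.rev_rev]
    -- The largest value becomes 0, so the order of the two chosen values is exchanged and the rows
    -- move up cyclically.
    have h1 : zone (finRotate n (π j)) (finRotate n (π i)) (finRotate n (π m)) =
        (zone (π i) (π j) (π m) + 1) % 3 := by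
      have hm' := val_finRotate (π m)
      have h2 := hmax m
      have h3 := π.injective.ne hi
      have h4 := π.injective.ne hj
      simp only [zone, Fin.lt_def, Fin.le_def, ne_eq, Fin.ext_iff] at *
      split_ifs <;> omega
    rw [zone_rev hi hj hij, h1, hst _ (zone_lt _ _ _) _ (zone_lt _ _ _)]
    exact h m hi hj

theorem Contains.of_shiftUp {n : ℕ} {s t : ℕ → ℕ → Bool} {π : Perm (Fin n)}
    (hs : ∀ a < 3, s a 2 = true) (hst : ∀ a < 3, ∀ b < 3, t (2 - a) ((b + 1) % 3) = s a b) :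
    Contains t (MeshPattern.shiftUp π) → Contains s π := by
  rintro ⟨j, i, hij, hπ, h⟩
  obtain ⟨j, rfl⟩ := Fin.rev_surjective j
  obtain ⟨i, rfl⟩ := Fin.rev_surjective i
  replace hij : i < j := by simpa using hij
  simp only [MeshPattern.shiftUp, Equiv.coe_fn_mk, Equiv.trans_apply, Fin.revPerm_apply,
    Fin.rev_rev] at hπ h
  replace h : ∀ m, m ≠ i → m ≠ j → t (2 - zone i j m)
      (zone (finRotate n (π j)) (finRotate n (π i)) (finRotate n (π m))) = false := by
    intro m hi hj
    have := h m.rev (by simpa using hj) (by simpa using hi)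
    rwa [zone_rev hi hj hij, Fin.rev_rev] at this
  -- The bottom row of `t` is the image of the top row of `s`, hence fully shaded.
  have hmin : ∀ m, finRotate n (π j) ≤ finRotate n (π m) := by
    intro m
    by_contra hlt
    have hz : zone (finRotate n (π j)) (finRotate n (π i)) (finRotate n (π m)) = 0 :=
      if_pos (not_le.1 hlt)
    have h1 := h m (by rintro rfl; exact hlt hπ.le) (by rintro rfl; exact hlt le_rfl)
    have h2 := hst _ (zone_lt i j m) 2 (by omega)
    rw [hs _ (zone_lt i j m)] at h2
    rw [hz] at h1
    simp [h1] at h2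
  have hj : (π j).val + 1 = n := by
    have hn := i.isLt
    have h1 := hmin (π.symm ⟨n - 1, by omega⟩)
    have h2 := val_finRotate (π j)
    have h3 := val_finRotate (⟨n - 1, by omega⟩ : Fin n)
    simp only [apply_symm_apply, Fin.le_def] at h1 h3
    omega
  have hj' := val_finRotate (π j)
  have hi' := val_finRotate (π i)
  refine ⟨i, j, hij, ?_, fun m hmi hmj => ?_⟩
  · rw [Fin.lt_def] at hπ ⊢
    omega
  · have h1 : zone (finRotate n (π j)) (finRotate n (π i)) (finRotate n (π m)) =
        (zone (π i) (π j) (π m) + 1) % 3 := by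
      have hm' := val_finRotate (π m)
      have h2 := hmin m
      have h3 := π.injective.ne hmi
      have h4 := π.injective.ne hmj
      simp only [zone, Fin.lt_def, Fin.le_def, ne_eq, Fin.ext_iff] at *
      split_ifs <;> omega
    rw [← hst _ (zone_lt _ _ _) _ (zone_lt _ _ _), ← h1]
    exact h m hmi hmj

theorem SameCount.shiftUp {s t : ℕ → ℕ → Bool} (hs : ∀ a < 3, s a 2 = true)
    (hst : ∀ a < 3, ∀ b < 3, t (2 - a) ((b + 1) % 3) = s a b) : SameCount s t := fun _ =>
  numAvoiding_eq_of_equiv MeshPattern.shiftUp (fun _ h => h.shiftUp hs hst)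
    (fun _ h => h.of_shiftUp hs hst)

/-! ### Reversing the values above the first letter -/

/-- The involution of `Fin n` that reverses the order of the elements above `v`. -/
def reverseAbove {n : ℕ} (v : Fin n) : Perm (Fin n) :=
  Function.Involutive.toPerm
    (fun x => if h : x ≤ v then x else ⟨n + v - x, by rw [Fin.le_def] at h; omega⟩) (by
      intro x
      ext
      simp only [Fin.le_def]
      split_ifs <;> simp_all only [] <;> omega)

theorem val_reverseAbove {n : ℕ} (v x : Fin n) :
    (reverseAbove v x).val = if x.val ≤ v.val then x.val else n + v - x := by
  simp only [reverseAbove, Function.Involutive.coe_toPerm, Fin.le_def]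
  split_ifs <;> rfl

theorem reverseAbove_self {n : ℕ} (v : Fin n) : reverseAbove v v = v := by
  ext; simp [val_reverseAbove]

theorem reverseAbove_reverseAbove {n : ℕ} (v x : Fin n) :
    reverseAbove v (reverseAbove v x) = x := by
  ext
  simp only [val_reverseAbove]
  split_ifs <;> omega

/-- The involution that reverses the order of the values above the first letter. -/
def reverseAboveFirst {n : ℕ} (π : Perm (Fin (n + 1))) : Perm (Fin (n + 1)) :=
  π.trans (reverseAbove (π 0))

theorem reverseAboveFirst_reverseAboveFirst {n : ℕ} (π : Perm (Fin (n + 1))) :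
    reverseAboveFirst (reverseAboveFirst π) = π := by
  ext x
  simp [reverseAboveFirst, reverseAbove_self, reverseAbove_reverseAbove]

theorem Contains.reverseAboveFirst {n : ℕ} {s t : ℕ → ℕ → Bool} {π : Perm (Fin (n + 1))}
    (hs : ∀ b < 3, s 0 b = true) (h0 : ∀ a < 3, t a 0 = s a 0) (h1 : ∀ a < 3, t a 1 = s a 2)
    (h2 : ∀ a < 3, t a 2 = s a 1) : Contains s π → Contains t (reverseAboveFirst π) := by
  rintro ⟨i, j, hij, hπ, h⟩
  -- With column 0 fully shaded, nothing may stand to the left of the first point.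
  obtain rfl : i = 0 := by
    by_contra hi
    have h3 := h 0 (Ne.symm hi) (by rintro rfl; exact absurd hij (Fin.not_lt_zero i))
    rw [show zone i j 0 = 0 from if_pos (Fin.pos_of_ne_zero hi), hs _ (zone_lt _ _ _)] at h3
    exact absurd h3 (by decide)
  refine ⟨0, j, hij, ?_, fun m hm0 hmj => ?_⟩
  · simp only [MeshPattern.reverseAboveFirst, Equiv.trans_apply, Fin.lt_def, val_reverseAbove] at *
    split_ifs <;> omega
  · have h3 := h m hm0 hmj
    have h4 := zone_lt 0 j m
    have h5 := π.injective.ne hm0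
    have h6 := π.injective.ne hmj
    simp only [MeshPattern.reverseAboveFirst, Equiv.trans_apply] at *
    -- Row 0 stays in place and rows 1 and 2 are exchanged.
    have h7 : zone (reverseAbove (π 0) (π 0)) (reverseAbove (π 0) (π j)) (reverseAbove (π 0) (π m))
        = if zone (π 0) (π j) (π m) = 0 then 0 else 3 - zone (π 0) (π j) (π m) := by
      simp only [zone, Fin.lt_def, val_reverseAbove, ne_eq, Fin.ext_iff] at *
      split_ifs <;> omega
    rw [h7]
    have h8 := zone_lt (π 0) (π j) (π m)
    generalize zone (π 0) (π j) (π m) = b at *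
    interval_cases b <;> simp_all

theorem SameCount.swapRows {s t : ℕ → ℕ → Bool} (hs : ∀ b < 3, s 0 b = true)
    (h0 : ∀ a < 3, t a 0 = s a 0) (h1 : ∀ a < 3, t a 1 = s a 2) (h2 : ∀ a < 3, t a 2 = s a 1) :
    SameCount s t := by
  rintro (_ | n)
  · rw [numAvoiding_zero, numAvoiding_zero]
  · refine numAvoiding_eq_of_equiv ⟨reverseAboveFirst, reverseAboveFirst,
      reverseAboveFirst_reverseAboveFirst, reverseAboveFirst_reverseAboveFirst⟩
      (fun π h => h.reverseAboveFirst hs h0 h1 h2) fun π h => ?_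
    have ht : ∀ b < 3, t 0 b = true := by
      intro b hb
      interval_cases b
      · rw [h0 0 hb, hs 0 hb]
      · rw [h1 0 (by omega), hs 2 (by omega)]
      · rw [h2 0 (by omega), hs 1 (by omega)]
    simpa [reverseAboveFirst_reverseAboveFirst] using h.reverseAboveFirst ht
      (fun a ha => (h0 a ha).symm) (fun a ha => (h2 a ha).symm) (fun a ha => (h1 a ha).symm)

/-! ### Inserting a point and appending a last letter -/

/-- The permutation that maps `p` to `v` and whose other letters are in the same relative order as
those of `π`. -/
def insertPoint {n : ℕ} (p v : Fin (n + 1)) (π : Perm (Fin n)) : Perm (Fin (n + 1)) :=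
  (finSuccEquiv' p).trans ((optionCongr π).trans (finSuccEquiv' v).symm)

@[simp]
theorem insertPoint_self {n : ℕ} (p v : Fin (n + 1)) (π : Perm (Fin n)) :
    insertPoint p v π p = v := by
  simp [insertPoint]

@[simp]
theorem insertPoint_succAbove {n : ℕ} (p v : Fin (n + 1)) (π : Perm (Fin n)) (i : Fin n) :
    insertPoint p v π (p.succAbove i) = v.succAbove (π i) := by
  simp [insertPoint]

@[simp]
theorem insertPoint_castSucc {n : ℕ} (v : Fin (n + 1)) (π : Perm (Fin n)) (i : Fin n) :
    insertPoint (Fin.last n) v π i.castSucc = v.succAbove (π i) := by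
  rw [← Fin.succAbove_last_apply, insertPoint_succAbove]

theorem insertPoint_bijective {n : ℕ} (p : Fin (n + 1)) :
    Function.Bijective fun x : Fin (n + 1) × Perm (Fin n) => insertPoint p x.1 x.2 := by
  rw [Fintype.bijective_iff_injective_and_card]
  constructor
  · rintro ⟨v, π⟩ ⟨w, σ⟩ h
    have hv : v = w := by simpa using congr($h p)
    subst hv
    simp only [Prod.mk.injEq, true_and]
    refine Equiv.ext fun i => ?_
    simpa [-EmbeddingLike.apply_eq_iff_eq] using congr($h (p.succAbove i))
  · simp [Fintype.card_perm, Nat.factorial_succ]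

theorem ncard_setOf_perm {n : ℕ} (p : Fin (n + 1)) (Q : Perm (Fin (n + 1)) → Prop) :
    {σ | Q σ}.ncard = {x : Fin (n + 1) × Perm (Fin n) | Q (insertPoint p x.1 x.2)}.ncard := by
  have h := insertPoint_bijective p
  rw [← Set.ncard_preimage_of_injective_subset_range h.injective
    (by rw [h.surjective.range_eq]; exact Set.subset_univ _)]
  rfl

theorem ncard_setOf_perm_apply {n : ℕ} (p v : Fin (n + 1)) (Q : Perm (Fin (n + 1)) → Prop) :
    {σ | Q σ ∧ σ p = v}.ncard = {π : Perm (Fin n) | Q (insertPoint p v π)}.ncard := by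
  rw [ncard_setOf_perm p]
  refine (Set.ncard_congr (fun π _ => (v, π)) (fun π hπ => by simpa using hπ) (by simp) ?_).symm
  rintro ⟨w, π⟩ ⟨hQ, hw⟩
  obtain rfl : w = v := by simpa using hw
  exact ⟨π, hQ, rfl⟩

theorem zone_castSucc {n : ℕ} (x y m : Fin n) :
    zone x.castSucc y.castSucc m.castSucc = zone x y m := by
  simp [zone]

theorem zone_succAbove {n : ℕ} (p : Fin (n + 1)) (x y m : Fin n) :
    zone (p.succAbove x) (p.succAbove y) (p.succAbove m) = zone x y m := by
  simp [zone]

/-- Appending the value `v` to `π` creates an occurrence. -/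
def CreatesOcc {n : ℕ} (s : ℕ → ℕ → Bool) (v : Fin (n + 1)) (π : Perm (Fin n)) : Prop :=
  ∃ i : Fin n, Occ s (insertPoint (Fin.last n) v π) i.castSucc (Fin.last n)

/-- A new last letter lies in column 2 of every old pair, where no box is shaded. -/
theorem occ_insertPoint_castSucc {n : ℕ} {s : ℕ → ℕ → Bool} (hs : ∀ b < 3, s 2 b = false)
    {v : Fin (n + 1)} {π : Perm (Fin n)} {i j : Fin n} :
    Occ s (insertPoint (Fin.last n) v π) i.castSucc j.castSucc ↔ Occ s π i j := by
  have h2 : zone i.castSucc j.castSucc (Fin.last n) = 2 := by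
    simp [zone, (Fin.castSucc_lt_last _).not_gt]
  simp only [Occ, Fin.forall_fin_succ', insertPoint_castSucc, zone_castSucc, zone_succAbove,
    Fin.castSucc_lt_castSucc_iff, Fin.succAbove_lt_succAbove_iff, ne_eq, Fin.castSucc_inj, h2,
    hs _ (zone_lt _ _ _), implies_true, and_true]

theorem contains_insertPoint_last {n : ℕ} {s : ℕ → ℕ → Bool} (hs : ∀ b < 3, s 2 b = false)
    {v : Fin (n + 1)} {π : Perm (Fin n)} :
    Contains s (insertPoint (Fin.last n) v π) ↔ Contains s π ∨ CreatesOcc s v π := by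
  constructor
  · rintro ⟨i, j, h⟩
    have hi : i ≠ Fin.last n := (h.1.trans_le (Fin.le_last j)).ne
    obtain ⟨i, rfl⟩ := Fin.exists_castSucc_eq.2 hi
    rcases eq_or_ne j (Fin.last n) with rfl | hj
    · exact .inr ⟨i, h⟩
    · obtain ⟨j, rfl⟩ := Fin.exists_castSucc_eq.2 hj
      exact .inl ⟨i, j, (occ_insertPoint_castSucc hs).1 h⟩
  · rintro (⟨i, j, h⟩ | ⟨i, h⟩)
    · exact ⟨_, _, (occ_insertPoint_castSucc hs).2 h⟩
    · exact ⟨_, _, h⟩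

/-- If the only way to create an occurrence by appending a value to `π` is to append `f π` in the
case `C π`, then the numbers of avoiders of lengths `n` and `n + 1` are related. -/
theorem numAvoiding_succ_add {n : ℕ} {s : ℕ → ℕ → Bool} (hs : ∀ b < 3, s 2 b = false)
    {C : Perm (Fin n) → Prop} {f : Perm (Fin n) → Fin (n + 1)}
    (h : ∀ v π, CreatesOcc s v π ↔ C π ∧ v = f π) :
    numAvoiding s (n + 1) + {π | ¬ Contains s π ∧ C π}.ncard = (n + 1) * numAvoiding s n := by
  have h1 : {π | ¬ Contains s π ∧ C π}.ncard =
      {x : Fin (n + 1) × Perm (Fin n) | ¬ Contains s x.2 ∧ C x.2 ∧ x.1 = f x.2}.ncard := by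
    refine Set.ncard_congr (fun π _ => (f π, π)) (fun π hπ => by simpa using hπ)
      (fun π σ _ _ he => (Prod.mk.inj he).2) ?_
    rintro ⟨v, π⟩ ⟨hπ, hC, hv⟩
    exact ⟨π, ⟨hπ, hC⟩, by simpa using hv.symm⟩
  have h2 : (n + 1) * numAvoiding s n =
      ((Set.univ : Set (Fin (n + 1))) ×ˢ {π : Perm (Fin n) | ¬ Contains s π}).ncard := by
    rw [Set.ncard_prod, Set.ncard_univ, Nat.card_fin, numAvoiding]
  rw [h2, h1, numAvoiding, ncard_setOf_perm (Fin.last n), ← Set.ncard_union_eq]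
  · congr 1
    ext ⟨v, π⟩
    simp only [contains_insertPoint_last hs, h, Set.mem_union, Set.mem_ofPred_eq, Set.mem_prod,
      Set.mem_univ, true_and]
    tauto
  · rw [Set.disjoint_left]
    rintro ⟨v, π⟩ h3 h4
    simp only [contains_insertPoint_last hs, h, Set.mem_ofPred_eq] at h3 h4
    tauto

theorem numAvoiding_one (s : ℕ → ℕ → Bool) : numAvoiding s 1 = 1 := by
  have : {π : Perm (Fin 1) | ¬ Contains s π} = {1} := by
    ext π
    simp [Contains, Occ, Subsingleton.elim π 1]
  rw [numAvoiding, this, Set.ncard_singleton]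

/-- Two patterns for which there is always exactly one value that creates an occurrence when it is
appended. -/
theorem SameCount.of_createsOcc_iff_eq {s t : ℕ → ℕ → Bool}
    (hs : ∀ b < 3, s 2 b = false) (ht : ∀ b < 3, t 2 b = false)
    {f g : ∀ n, Perm (Fin (n + 1)) → Fin (n + 2)}
    (hf : ∀ n v π, CreatesOcc s v π ↔ v = f n π) (hg : ∀ n v π, CreatesOcc t v π ↔ v = g n π) :
    SameCount s t := by
  have key : ∀ {s : ℕ → ℕ → Bool} {f : ∀ n, Perm (Fin (n + 1)) → Fin (n + 2)},
      (∀ b < 3, s 2 b = false) → (∀ n v π, CreatesOcc s v π ↔ v = f n π) →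
      -- Of the `n + 2` values that can be appended to an avoider of length `n + 1`, exactly one is
      -- forbidden, which leaves a factor `n + 1`.
      ∀ n, numAvoiding s (n + 1) = n.factorial := by
    intro s f hs hf n
    induction n with
    | zero => exact numAvoiding_one s
    | succ n ih =>
      have h := numAvoiding_succ_add (C := fun _ => True) hs (fun v π => by rw [hf n v π, true_and])
      simp only [and_true] at h
      change _ + numAvoiding s (n + 1) = _ at h
      rw [Nat.factorial_succ]
      rw [ih] at h
      linarith
  rintro (_ | n)
  · rw [numAvoiding_zero, numAvoiding_zero]
  · rw [key hs hf, key ht hg]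

/-- The last letter `u` and an appended value `v` are an occurrence in which the boxes to the left
are empty. -/
def CreatesAdjacentOcc {n : ℕ} (s : ℕ → ℕ → Bool) (u : Fin (n + 1)) (v : Fin (n + 2)) : Prop :=
  u.castSucc < v ∧
    ∀ w, w ≠ u → s 0 (if w < u then 0 else if w.castSucc < v then 1 else 2) = false

/-- Since column 1 is shaded, the first point must be adjacent to the appended one. All other
letters then lie in column 0, so only their values matter, and these are all values other than that
of the last letter. -/
theorem createsOcc_iff {n : ℕ} {s : ℕ → ℕ → Bool} (h1 : ∀ b < 3, s 1 b = true)
    {v : Fin (n + 2)} {π : Perm (Fin (n + 1))} :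
    CreatesOcc s v π ↔ CreatesAdjacentOcc s (π (Fin.last n)) v := by
  have hv : ∀ w : Fin (n + 1), v.succAbove w < v ↔ w.castSucc < v := fun w =>
    Fin.succAbove_lt_iff_castSucc_lt v w
  have hz : ∀ w, zone (v.succAbove (π (Fin.last n))) v (v.succAbove w) =
      if w < π (Fin.last n) then 0 else if w.castSucc < v then 1 else 2 := by
    simp [zone, hv]
  have h0 : ∀ i : Fin (n + 1), i ≠ Fin.last n →
      zone (Fin.last n).castSucc (Fin.last (n + 1)) i.castSucc = 0 := by
    intro i hi
    simp [zone, Fin.lt_last_iff_ne_last.2 hi]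
  constructor
  · rintro ⟨i, hi, hv', h⟩
    obtain rfl : i = Fin.last n := by
      by_contra hne
      have h2 := h (Fin.last n).castSucc (by simpa using Ne.symm hne)
        (Fin.castSucc_lt_last _).ne
      have h3 : zone i.castSucc (Fin.last (n + 1)) (Fin.last n).castSucc = 1 := by
        have : i < Fin.last n := Fin.lt_last_iff_ne_last.2 hne
        simp [zone, this.not_gt]
      rw [h3, h1 _ (zone_lt _ _ _)] at h2
      exact absurd h2 (by decide)
    refine ⟨by simpa [hv] using hv', fun w hw => ?_⟩
    obtain ⟨m, rfl⟩ := π.surjective w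
    have hm : m ≠ Fin.last n := fun e => hw (by rw [e])
    have h2 := h m.castSucc (by simpa using hm) (Fin.castSucc_lt_last _).ne
    simpa only [h0 m hm, insertPoint_castSucc, insertPoint_self, hz] using h2
  · rintro ⟨hlt, h⟩
    refine ⟨Fin.last n, Fin.castSucc_lt_last _, by simpa [hv] using hlt, fun m hm hm' => ?_⟩
    obtain ⟨m, rfl⟩ := Fin.exists_castSucc_eq.2 hm'
    have hm : m ≠ Fin.last n := fun e => hm (by rw [e])
    have h2 := h (π m) (π.injective.ne hm)
    simpa only [h0 m hm, insertPoint_castSucc, insertPoint_self, hz] using h2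

/-! ### The pairs of shadings settled by counting -/

/-- The set of boxes encoded by the binary digits of `M`. -/
def shading (M : ℕ) (a b : ℕ) : Bool := M.testBit (3 * a + b)

/-- Column 1 and box `(0, 2)` are shaded: no earlier letter may exceed the appended one. -/
theorem createsOcc_shading_60 {n : ℕ} (v : Fin (n + 2)) (π : Perm (Fin (n + 1))) :
    CreatesOcc (shading 60) v π ↔ v = Fin.last (n + 1) := by
  rw [createsOcc_iff (by decide)]
  constructor
  · rintro ⟨hlt, h⟩
    by_contra hv
    have hv' := Fin.val_lt_last hv
    have h1 := h ⟨v, hv'⟩ (by rintro e; simp [← e] at hlt)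
    rw [if_neg (by simp only [Fin.lt_def, Fin.val_castSucc] at *; omega), if_neg (by simp)] at h1
    exact absurd h1 (by decide)
  · rintro rfl
    refine ⟨Fin.castSucc_lt_last _, fun w _ => ?_⟩
    rw [if_pos (Fin.castSucc_lt_last _)]
    split_ifs <;> decide

/-- Column 1 and box `(0, 1)` are shaded: no value may separate the last two letters. -/
theorem createsOcc_shading_58 {n : ℕ} (v : Fin (n + 2)) (π : Perm (Fin (n + 1))) :
    CreatesOcc (shading 58) v π ↔ v = (π (Fin.last n)).succ := by
  rw [createsOcc_iff (by decide)]
  generalize π (Fin.last n) = u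
  constructor
  · rintro ⟨hlt, h⟩
    by_contra hv
    simp only [Fin.lt_def, Fin.val_castSucc, Fin.ext_iff, Fin.val_succ] at hlt hv
    have h1 := h ⟨u + 1, by omega⟩ (by simp [Fin.ext_iff])
    rw [if_neg (by simp [Fin.lt_def]), if_pos (by simp [Fin.lt_def]; omega)] at h1
    exact absurd h1 (by decide)
  · rintro rfl
    refine ⟨Fin.castSucc_lt_succ, fun w hw => ?_⟩
    have hw' : w.val ≠ u.val := fun e => hw (Fin.ext e)
    simp only [Fin.lt_def, Fin.val_castSucc, Fin.val_succ]
    split_ifs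
    · decide
    · omega
    · decide

/-- Column 1, `(0, 0)` and `(0, 2)` are shaded: all other values lie between the last two letters.
-/
theorem createsOcc_shading_61 {n : ℕ} (v : Fin (n + 2)) (π : Perm (Fin (n + 1))) :
    CreatesOcc (shading 61) v π ↔ π (Fin.last n) = 0 ∧ v = Fin.last (n + 1) := by
  rw [createsOcc_iff (by decide)]
  generalize π (Fin.last n) = u
  constructor
  · rintro ⟨hlt, h⟩
    constructor
    · by_contra hu
      have h1 := h 0 (Ne.symm hu)
      rw [if_pos (Fin.pos_of_ne_zero hu)] at h1
      exact absurd h1 (by decide)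
    · by_contra hv
      have hv' := Fin.val_lt_last hv
      have h1 := h ⟨v, hv'⟩ (by rintro e; simp [← e] at hlt)
      rw [if_neg (by simp only [Fin.lt_def, Fin.val_castSucc] at *; omega), if_neg (by simp)] at h1
      exact absurd h1 (by decide)
  · rintro ⟨rfl, rfl⟩
    refine ⟨Fin.castSucc_lt_last _, fun w _ => ?_⟩
    rw [if_neg (Fin.not_lt_zero w), if_pos (Fin.castSucc_lt_last _)]
    decide

/-- Column 1, `(0, 0)` and `(0, 1)` are shaded: all other values lie above the last two letters. -/
theorem createsOcc_shading_59 {n : ℕ} (v : Fin (n + 2)) (π : Perm (Fin (n + 1))) :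
    CreatesOcc (shading 59) v π ↔ π (Fin.last n) = 0 ∧ v = 1 := by
  rw [createsOcc_iff (by decide)]
  generalize π (Fin.last n) = u
  constructor
  · rintro ⟨hlt, h⟩
    obtain rfl : u = 0 := by
      by_contra hu
      have h1 := h 0 (Ne.symm hu)
      rw [if_pos (Fin.pos_of_ne_zero hu)] at h1
      exact absurd h1 (by decide)
    refine ⟨rfl, ?_⟩
    by_contra hv
    simp only [Fin.lt_def, Fin.val_castSucc, Fin.ext_iff, Fin.val_zero, Fin.val_one] at hlt hv
    have h1 := h ⟨1, by omega⟩ (by simp [Fin.ext_iff])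
    rw [if_neg (Fin.not_lt_zero _), if_pos (by simp only [Fin.lt_def, Fin.val_castSucc]; omega)]
      at h1
    exact absurd h1 (by decide)
  · rintro ⟨rfl, rfl⟩
    refine ⟨by simp, fun w hw => ?_⟩
    have hw' := Fin.pos_of_ne_zero hw
    rw [if_neg (Fin.not_lt_zero w), if_neg (by
      simp only [Fin.lt_def, Fin.val_castSucc, Fin.val_one, Fin.val_zero] at *; omega)]
    decide

/-- Column 1, `(0, 1)` and `(0, 2)` are shaded: all other values lie below the last two letters. -/
theorem createsOcc_shading_62 {n : ℕ} (v : Fin (n + 2)) (π : Perm (Fin (n + 1))) :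
    CreatesOcc (shading 62) v π ↔ π (Fin.last n) = Fin.last n ∧ v = Fin.last (n + 1) := by
  rw [createsOcc_iff (by decide)]
  generalize π (Fin.last n) = u
  constructor
  · rintro ⟨hlt, h⟩
    obtain rfl : u = Fin.last n := by
      by_contra hu
      have h1 := h (Fin.last n) (Ne.symm hu)
      rw [if_neg (Fin.le_last u).not_gt] at h1
      split_ifs at h1 <;> exact absurd h1 (by decide)
    refine ⟨rfl, ?_⟩
    simp only [Fin.lt_def, Fin.val_castSucc, Fin.ext_iff, Fin.val_last] at hlt ⊢
    omega
  · rintro ⟨rfl, rfl⟩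
    refine ⟨Fin.castSucc_lt_last _, fun w hw => ?_⟩
    rw [if_pos (Fin.lt_last_iff_ne_last.2 hw)]
    decide

/-- The boxes `(a, b)` with `a, b < 2` are shaded, so every other letter exceeds the appended one.
The first point is thus the smallest letter, wherever it stands; column 1 is not fully shaded and
`createsOcc_iff` does not apply. -/
theorem createsOcc_shading_27 {n : ℕ} (v : Fin (n + 2)) (π : Perm (Fin (n + 1))) :
    CreatesOcc (shading 27) v π ↔ v = 1 := by
  have hv : ∀ w : Fin (n + 1), v.succAbove w < v ↔ w.castSucc < v := fun w =>
    Fin.succAbove_lt_iff_castSucc_lt v w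
  have key : ∀ a < 2, ∀ b < 3, shading 27 a b = false ↔ b = 2 := by decide
  have hza : ∀ i m : Fin (n + 1), zone i.castSucc (Fin.last (n + 1)) m.castSucc < 2 := by
    intro i m
    simp only [zone, Fin.castSucc_lt_last, if_true]
    split_ifs <;> decide
  have hzb : ∀ u w : Fin (n + 1), w ≠ u → u.castSucc < v →
      (zone (v.succAbove u) v (v.succAbove w) = 2 ↔ ¬ w.castSucc < v) := by
    intro u w hwu huv
    simp only [zone, hv, Fin.succAbove_lt_succAbove_iff]
    split_ifs with h1 h2
    · simpa using (Fin.castSucc_lt_castSucc_iff.2 h1).trans huv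
    · simpa using h2
    · simpa using h2
  constructor
  · rintro ⟨i, -, hlt, h⟩
    simp only [insertPoint_castSucc, insertPoint_self, hv] at hlt
    have h' : ∀ w, w ≠ π i → ¬ w.castSucc < v := by
      intro w hw
      obtain ⟨m, rfl⟩ := π.surjective w
      have hm : m ≠ i := fun e => hw (by rw [e])
      have h1 := h m.castSucc (by simpa using hm) (Fin.castSucc_lt_last _).ne
      rw [key _ (hza i m) _ (zone_lt _ _ _)] at h1
      simpa only [insertPoint_castSucc, insertPoint_self, hzb _ _ hw hlt] using h1
    have h0 := h' 0
    by_contra hv1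
    rcases Nat.lt_or_ge 1 v with h2 | h2
    · have h1 := h' ⟨1, by omega⟩
      simp only [Fin.lt_def, Fin.val_castSucc, ne_eq, Fin.ext_iff, Fin.val_zero] at *
      omega
    · simp only [Fin.lt_def, Fin.val_castSucc, Fin.ext_iff, Fin.val_one] at *
      omega
  · rintro rfl
    have hlt : (π (π.symm 0)).castSucc < 1 := by simp
    refine ⟨π.symm 0, Fin.castSucc_lt_last _, ?_, fun m hm hm' => ?_⟩
    · simpa only [insertPoint_castSucc, insertPoint_self, hv] using hlt
    · obtain ⟨m, rfl⟩ := Fin.exists_castSucc_eq.2 hm'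
      have hm : π m ≠ π (π.symm 0) := fun e => hm (by rw [π.injective e])
      rw [key _ (hza _ m) _ (zone_lt _ _ _), insertPoint_castSucc, insertPoint_castSucc,
        insertPoint_self, hzb _ _ hm hlt]
      rw [apply_symm_apply] at hm
      have := Fin.pos_of_ne_zero hm
      simp only [Fin.lt_def, Fin.val_castSucc, Fin.val_one, Fin.val_zero] at *
      omega

theorem sameCount_60_27 : SameCount (shading 60) (shading 27) :=
  .of_createsOcc_iff_eq (by decide) (by decide) (fun _ => createsOcc_shading_60)
    (fun _ => createsOcc_shading_27)

theorem sameCount_60_58 : SameCount (shading 60) (shading 58) :=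
  .of_createsOcc_iff_eq (by decide) (by decide) (fun _ => createsOcc_shading_60)
    (fun _ => createsOcc_shading_58)

/-- The number of avoiders of length `n + 1` that end in their smallest letter is the number of
avoiders of length `n`, if appending the smallest letter never creates an occurrence. -/
theorem numAvoiding_rec_of_last_eq_zero {s : ℕ → ℕ → Bool} (hs : ∀ b < 3, s 2 b = false)
    {f : ∀ n, Perm (Fin (n + 1)) → Fin (n + 2)} (hf : ∀ n π, f n π ≠ 0)
    (h : ∀ n v π, CreatesOcc s v π ↔ π (Fin.last n) = 0 ∧ v = f n π) (n : ℕ) :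
    numAvoiding s (n + 2) + numAvoiding s n = (n + 2) * numAvoiding s (n + 1) := by
  rw [← numAvoiding_succ_add hs (h n), ncard_setOf_perm_apply]
  congr 1
  rw [numAvoiding]
  congr 1
  ext π
  simp only [Set.mem_ofPred_eq, contains_insertPoint_last hs, not_or, iff_self_and]
  rintro -
  cases n with
  | zero => rintro ⟨i, -⟩; exact i.elim0
  | succ n => rw [h]; exact fun e => hf _ _ e.2.symm

theorem sameCount_61_59 : SameCount (shading 61) (shading 59) := by
  have h1 := numAvoiding_rec_of_last_eq_zero (s := shading 61) (by decide)
    (f := fun n _ => Fin.last (n + 1)) (fun n _ => by simp [Fin.ext_iff])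
    (fun _ => createsOcc_shading_61)
  have h2 := numAvoiding_rec_of_last_eq_zero (s := shading 59) (by decide)
    (f := fun n _ => 1) (fun n _ => one_ne_zero) (fun _ => createsOcc_shading_59)
  intro n
  induction n using Nat.twoStepInduction with
  | zero => rw [numAvoiding_zero, numAvoiding_zero]
  | one => rw [numAvoiding_one, numAvoiding_one]
  | more n ih1 ih2 =>
    have h3 := h1 n
    have h4 := h2 n
    rw [ih1, ih2] at h3
    omega

theorem numAvoiding_shading_62 (n : ℕ) : numAvoiding (shading 62) (n + 2) =
    (n + 1) * numAvoiding (shading 62) (n + 1) + n * numAvoiding (shading 62) n := by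
  have hs : ∀ b < 3, shading 62 2 b = false := by decide
  set B : ℕ → ℕ := fun n =>
    {π : Perm (Fin (n + 1)) | ¬ Contains (shading 62) π ∧ π (Fin.last n) = Fin.last n}.ncard with hB
  have h1 : ∀ n, numAvoiding (shading 62) (n + 2) + B n =
      (n + 2) * numAvoiding (shading 62) (n + 1) := fun n =>
    numAvoiding_succ_add hs (fun v π => createsOcc_shading_62 v π)
  -- Appending the largest value to an avoider stays harmless unless it already ends in its largest
  -- letter. Eliminating `B` from this and `h1` gives the recurrence.
  have h2 : ∀ n, B (n + 1) + B n = numAvoiding (shading 62) (n + 1) := by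
    intro n
    simp only [hB]
    rw [ncard_setOf_perm_apply, numAvoiding, ← Set.ncard_union_eq]
    · congr 1
      ext π
      simp only [contains_insertPoint_last hs, createsOcc_shading_62, Set.mem_union,
        Set.mem_ofPred_eq, and_true]
      tauto
    · rw [Set.disjoint_left]
      intro π h3 h4
      simp only [contains_insertPoint_last hs, createsOcc_shading_62, Set.mem_ofPred_eq] at h3 h4
      tauto
  cases n with
  | zero =>
    have h3 := h1 0
    have h4 : B 0 = numAvoiding (shading 62) 1 := by
      simp only [hB, numAvoiding]
      congr 1
      ext π
      have : π (Fin.last 0) = Fin.last 0 := Subsingleton.elim (α := Fin 1) _ _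
      simp only [this, Set.mem_ofPred_eq, and_true]
    rw [numAvoiding_one] at h4
    simp only [zero_add, numAvoiding_one] at *
    omega
  | succ n =>
    have h3 := h1 n
    have h4 := h1 (n + 1)
    have h5 := h2 n
    simp only [add_assoc, Nat.reduceAdd] at *
    linarith

/-! ### Successions and the shading 186 -/

/-- The positions `a`, `b` are adjacent and carry adjacent values, both in increasing order. -/
def Succession {n : ℕ} (π : Perm (Fin n)) (a b : Fin n) : Prop :=
  b.val = a.val + 1 ∧ (π b).val = (π a).val + 1

/-- The number 186 encodes the middle row together with the middle column; emptiness of the column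
makes the positions adjacent, that of the row the values. -/
theorem contains_shading_186 {n : ℕ} {π : Perm (Fin n)} :
    Contains (shading 186) π ↔ ∃ a b, Succession π a b := by
  have key : ∀ a < 3, ∀ b < 3, shading 186 a b = false ↔ a ≠ 1 ∧ b ≠ 1 := by decide
  refine exists_congr fun i => exists_congr fun j => ⟨fun ⟨hij, hπ, h⟩ => ?_, fun ⟨hij, hπ⟩ => ?_⟩
  · have h' : ∀ m, m ≠ i → m ≠ j → zone i j m ≠ 1 ∧ zone (π i) (π j) (π m) ≠ 1 :=
      fun m hi hj => (key _ (zone_lt _ _ _) _ (zone_lt _ _ _)).1 (h m hi hj)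
    simp only [zone, Fin.lt_def] at h' hij hπ
    constructor
    · have h1 := h' ⟨i + 1, by omega⟩
      simp only [ne_eq, Fin.ext_iff] at h1
      by_contra hne
      have h2 := (h1 (by omega) (by omega)).1
      split_ifs at h2 <;> omega
    · by_contra hne
      have h1 := h' (π.symm ⟨π i + 1, by omega⟩)
        (fun e => by rw [symm_apply_eq, Fin.ext_iff] at e; simp at e)
        (fun e => by rw [symm_apply_eq, Fin.ext_iff] at e; simp at e; omega)
      rw [apply_symm_apply] at h1
      have h2 := h1.2
      (split_ifs at h2 <;> simp_all); omega
  · refine ⟨by rw [Fin.lt_def]; omega, by rw [Fin.lt_def]; omega, fun m hi hj => ?_⟩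
    rw [key _ (zone_lt _ _ _) _ (zone_lt _ _ _)]
    have h1 := π.injective.ne hi
    have h2 := π.injective.ne hj
    simp only [zone, ne_eq, Fin.ext_iff, Fin.lt_def] at *
    constructor <;> split_ifs <;> first | omega | simp

/-- A new point destroys a succession only by separating its positions or its values. -/
theorem succession_insertPoint_succAbove {n : ℕ} {p v : Fin (n + 1)} {π : Perm (Fin n)}
    {a b : Fin n} : Succession (insertPoint p v π) (p.succAbove a) (p.succAbove b) ↔
      Succession π a b ∧ p ≠ b.castSucc ∧ v ≠ (π b).castSucc := by
  simp only [Succession, insertPoint_succAbove]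
  simp only [Fin.succAbove, Fin.lt_def, Fin.ext_iff, ne_eq,
    Fin.val_castSucc]
  split_ifs <;> simp only [Fin.val_castSucc, Fin.val_succ] <;> omega

theorem succession_insertPoint_right {n : ℕ} {p v : Fin (n + 1)} {π : Perm (Fin n)}
    {a : Fin n} : Succession (insertPoint p v π) (p.succAbove a) p ↔
      p = a.succ ∧ v = (π a).succ := by
  simp only [Succession, insertPoint_succAbove, insertPoint_self]
  simp only [Fin.succAbove, Fin.lt_def,
    Fin.ext_iff, Fin.val_castSucc, Fin.val_succ]
  split_ifs <;> simp only [Fin.val_castSucc, Fin.val_succ] <;> omega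

theorem succession_insertPoint_left {n : ℕ} {p v : Fin (n + 1)} {π : Perm (Fin n)}
    {b : Fin n} : Succession (insertPoint p v π) p (p.succAbove b) ↔
      p = b.castSucc ∧ v = (π b).castSucc := by
  simp only [Succession, insertPoint_succAbove, insertPoint_self]
  simp only [Fin.succAbove, Fin.lt_def,
    Fin.ext_iff, Fin.val_castSucc]
  split_ifs <;> simp only [Fin.val_castSucc, Fin.val_succ] <;> omega

theorem not_succession_self {n : ℕ} {π : Perm (Fin n)} {a : Fin n} : ¬ Succession π a a :=
  fun h => by have := h.1; omega

/-- The permutation has exactly one succession, and it ends at the position `b`. -/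
def UniqueSuccession {n : ℕ} (π : Perm (Fin n)) (b : Fin n) : Prop :=
  (∃ a, Succession π a b) ∧ ∀ a b', Succession π a b' → b' = b

/-- The point at `i` is doubled, which creates one succession. An old succession starting at `i` now
starts at the new point, and every other one survives, so none is lost. -/
theorem uniqueSuccession_insertPoint {n : ℕ} {i : Fin n} {π : Perm (Fin n)} :
    UniqueSuccession (insertPoint i.succ (π i).succ π) i.succ ↔ ∀ a b, ¬ Succession π a b := by
  have h0 : ∀ b, Succession π i b ↔ i.succ = b.castSucc ∧ (π i).succ = (π b).castSucc := by
    simp [Succession, Fin.ext_iff, eq_comm]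
  constructor
  · rintro ⟨-, h⟩ a b hab
    rcases eq_or_ne a i with rfl | ha
    · exact Fin.succAbove_ne _ _ (h _ _ (succession_insertPoint_left.2 ((h0 b).1 hab)))
    · refine Fin.succAbove_ne _ _ (h _ _ (succession_insertPoint_succAbove.2 ⟨hab, ?_, ?_⟩))
      · intro e
        rw [Fin.ext_iff, Fin.val_succ, Fin.val_castSucc] at e
        exact ha (Fin.ext (by have := hab.1; omega))
      · intro e
        rw [Fin.ext_iff, Fin.val_succ, Fin.val_castSucc] at e
        exact ha (π.injective (Fin.ext (by have := hab.2; omega)))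
  · intro h
    refine ⟨⟨i.succ.succAbove i, succession_insertPoint_right.2 ⟨rfl, rfl⟩⟩, fun a b hab => ?_⟩
    by_contra hb
    obtain ⟨b, rfl⟩ := Fin.exists_succAbove_eq hb
    rcases eq_or_ne a i.succ with rfl | ha
    · exact h _ _ ((h0 b).2 (succession_insertPoint_left.1 hab))
    · obtain ⟨a, rfl⟩ := Fin.exists_succAbove_eq ha
      exact h _ _ (succession_insertPoint_succAbove.1 hab).1

/-- Contracting the only succession to a point gives an avoider with a marked point, and doubling
the marked point inverts this. -/
theorem ncard_uniqueSuccession (n : ℕ) :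
    {x : Fin (n + 1) × Perm (Fin (n + 1)) | UniqueSuccession x.2 x.1}.ncard =
      n * numAvoiding (shading 186) n := by
  have h : n * numAvoiding (shading 186) n = ((Set.univ : Set (Fin n)) ×ˢ
      {π : Perm (Fin n) | ¬ Contains (shading 186) π}).ncard := by
    rw [Set.ncard_prod, Set.ncard_univ, Nat.card_fin, numAvoiding]
  rw [h]
  refine (Set.ncard_congr
    (fun x _ => (x.1.succ, insertPoint x.1.succ (x.2 x.1).succ x.2)) ?_ ?_ ?_).symm
  · rintro ⟨i, π⟩ ⟨-, hπ⟩
    simp only [Set.mem_ofPred_eq, contains_shading_186] at hπ ⊢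
    exact uniqueSuccession_insertPoint.2 fun a b h => hπ ⟨a, b, h⟩
  · rintro ⟨i, π⟩ ⟨j, σ⟩ - - he
    simp only [Prod.mk.injEq, Fin.succ_inj] at he
    obtain ⟨rfl, he⟩ := he
    have := (insertPoint_bijective i.succ).injective (a₁ := (_, _)) (a₂ := (_, _)) he
    rw [(Prod.mk.inj this).2]
  · rintro ⟨p, σ⟩ hσ
    obtain ⟨⟨v, π⟩, rfl⟩ := (insertPoint_bijective p).surjective σ
    simp only [Set.mem_ofPred_eq] at hσ
    obtain ⟨a, ha⟩ := hσ.1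
    obtain ⟨i, rfl⟩ := Fin.exists_succAbove_eq
      (show a ≠ p by rintro rfl; exact not_succession_self ha)
    obtain ⟨rfl, rfl⟩ := succession_insertPoint_right.1 ha
    refine ⟨(i, π), ⟨trivial, ?_⟩, rfl⟩
    simp only [Set.mem_ofPred_eq, contains_shading_186]
    rintro ⟨a, b, h⟩
    exact uniqueSuccession_insertPoint.1 hσ a b h

theorem contains_shading_186_insertPoint_last {n : ℕ} {v : Fin (n + 2)}
    {π : Perm (Fin (n + 1))} :
    Contains (shading 186) (insertPoint (Fin.last (n + 1)) v π) ↔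
      v = (π (Fin.last n)).succ ∨ ∃ a b, Succession π a b ∧ v ≠ (π b).castSucc := by
  rw [contains_shading_186]
  constructor
  · rintro ⟨a, b, h⟩
    have ha : a ≠ Fin.last (n + 1) := by
      rintro rfl
      have h1 := h.1
      rw [Fin.val_last] at h1
      omega
    obtain ⟨a, rfl⟩ := Fin.exists_succAbove_eq ha
    rcases eq_or_ne b (Fin.last (n + 1)) with rfl | hb
    · obtain ⟨h1, h2⟩ := succession_insertPoint_right.1 h
      obtain rfl : a = Fin.last n := by
        rw [← Fin.succ_last, Fin.succ_inj] at h1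
        exact h1.symm
      exact .inl h2
    · obtain ⟨b, rfl⟩ := Fin.exists_succAbove_eq hb
      obtain ⟨h1, -, h2⟩ := succession_insertPoint_succAbove.1 h
      exact .inr ⟨a, b, h1, h2⟩
  · rintro (h | ⟨a, b, h, hv⟩)
    · exact ⟨_, _, succession_insertPoint_right.2 ⟨(Fin.succ_last n).symm, h⟩⟩
    · exact ⟨_, _, succession_insertPoint_succAbove.2 ⟨h, (Fin.castSucc_lt_last b).ne', hv⟩⟩

/-- Delete the last letter. If an avoider remains (`A`), one value was forbidden, giving `(n + 1)`
choices per avoider. Otherwise (`B`) the deleted value split the only succession, which determines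
that value. -/
theorem numAvoiding_shading_186 (n : ℕ) : numAvoiding (shading 186) (n + 2) =
    (n + 1) * numAvoiding (shading 186) (n + 1) + n * numAvoiding (shading 186) n := by
  set A : Set (Fin (n + 2) × Perm (Fin (n + 1))) :=
    {x | ¬ Contains (shading 186) x.2 ∧ x.1 ≠ (x.2 (Fin.last n)).succ} with hA
  set A' : Set (Fin (n + 2) × Perm (Fin (n + 1))) :=
    {x | ¬ Contains (shading 186) x.2 ∧ x.1 = (x.2 (Fin.last n)).succ} with hA'
  set B : Set (Fin (n + 2) × Perm (Fin (n + 1))) :=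
    {x | ∃ b, UniqueSuccession x.2 b ∧ x.1 = (x.2 b).castSucc} with hB
  have h1 : numAvoiding (shading 186) (n + 2) = A.ncard + B.ncard := by
    rw [numAvoiding, ncard_setOf_perm (Fin.last (n + 1)), ← Set.ncard_union_eq]
    · congr 1
      ext ⟨v, π⟩
      simp only [contains_shading_186_insertPoint_last, hA, hB, Set.mem_union, Set.mem_ofPred_eq]
      rw [contains_shading_186]
      constructor
      · intro h
        by_cases hπ : ∃ a b, Succession π a b
        · obtain ⟨a, b, hab⟩ := hπ
          have h2 : ∀ a b, Succession π a b → v = (π b).castSucc := by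
            intro a b hab
            by_contra hne
            exact h (.inr ⟨a, b, hab, hne⟩)
          refine .inr ⟨b, ⟨⟨a, hab⟩, fun a' b' h' => ?_⟩, h2 a b hab⟩
          have := (h2 a' b' h').symm.trans (h2 a b hab)
          exact π.injective (Fin.castSucc_injective _ this)
        · exact .inl ⟨hπ, fun e => h (.inl e)⟩
      · rintro (⟨hπ, hv⟩ | ⟨b, ⟨⟨a, hab⟩, hu⟩, rfl⟩)
        · rintro (h | ⟨a, b, hab, -⟩)
          · exact hv h
          · exact hπ ⟨a, b, hab⟩
        · rintro (h | ⟨a', b', hab', hne⟩)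
          -- The value just above the last letter would be `π b`, so the succession would start at
          -- the last position, leaving no room for `b`.
          · have h2 : a = Fin.last n := by
              apply π.injective
              have := hab.2
              rw [Fin.ext_iff, Fin.val_castSucc, Fin.val_succ] at h
              exact Fin.ext (by omega)
            have h3 := hab.1
            rw [h2, Fin.val_last] at h3
            omega
          · exact hne (by rw [hu a' b' hab'])
    · rw [Set.disjoint_left]
      rintro ⟨v, π⟩ ⟨h2, -⟩ ⟨b, ⟨⟨a, hab⟩, -⟩, -⟩
      exact h2 (contains_shading_186.2 ⟨a, b, hab⟩)
  have h2 : A.ncard + A'.ncard = (n + 2) * numAvoiding (shading 186) (n + 1) := by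
    have h3 : (n + 2) * numAvoiding (shading 186) (n + 1) = ((Set.univ : Set (Fin (n + 2))) ×ˢ
        {π : Perm (Fin (n + 1)) | ¬ Contains (shading 186) π}).ncard := by
      rw [Set.ncard_prod, Set.ncard_univ, Nat.card_fin, numAvoiding]
    rw [h3, ← Set.ncard_union_eq]
    · congr 1
      ext ⟨v, π⟩
      simp only [hA, hA', Set.mem_union, Set.mem_ofPred_eq, Set.mem_prod, Set.mem_univ, true_and]
      tauto
    · rw [Set.disjoint_left]
      exact fun x h3 h4 => h3.2 h4.2
  have h3 : numAvoiding (shading 186) (n + 1) = A'.ncard := by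
    refine Set.ncard_congr (fun π _ => ((π (Fin.last n)).succ, π)) (fun π hπ => ⟨hπ, rfl⟩)
      (fun π σ _ _ he => (Prod.mk.inj he).2) ?_
    rintro ⟨v, π⟩ ⟨hπ, hv⟩
    exact ⟨π, hπ, by simpa using hv.symm⟩
  have h4 : n * numAvoiding (shading 186) n = B.ncard := by
    rw [← ncard_uniqueSuccession]
    refine Set.ncard_congr (fun x _ => ((x.2 x.1).castSucc, x.2)) (fun x hx => ⟨x.1, hx, rfl⟩)
      ?_ ?_
    · rintro ⟨b, π⟩ ⟨b', σ⟩ - - he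
      obtain ⟨h5, rfl⟩ := Prod.mk.inj he
      exact Prod.ext (π.injective (Fin.castSucc_injective _ h5)) rfl
    · rintro ⟨v, π⟩ ⟨b, hb, hv⟩
      exact ⟨(b, π), hb, Prod.ext hv.symm rfl⟩
  rw [h1, h4]
  rw [← h3] at h2
  linarith

theorem sameCount_62_186 : SameCount (shading 62) (shading 186) := by
  intro n
  induction n using Nat.twoStepInduction with
  | zero => rw [numAvoiding_zero, numAvoiding_zero]
  | one => rw [numAvoiding_one, numAvoiding_one]
  | more n ih1 ih2 => rw [numAvoiding_shading_62, numAvoiding_shading_186, ih1, ih2]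

/-! ### The graph of elementary equivalences and its forest -/

/-- Every box that is shaded in `M` is shaded in `N`. -/
def ShadingLE (M N : ℕ) : Prop :=
  ∀ a < 3, ∀ b < 3, shading M a b = true → shading N a b = true

/-- `N` arises from `M` by shading the box `(x, y)`. -/
def AddsBox (x y M N : ℕ) : Prop :=
  ShadingLE M N ∧
    ∀ a < 3, ∀ b < 3, shading N a b = true → shading M a b = true ∨ a = x ∧ b = y

/-- `N` arises from `M` by the transposition or by the half turn of the diagram. -/
def SymmetryStep (M N : ℕ) : Prop :=
  (∀ a < 3, ∀ b < 3, shading N b a = shading M a b) ∨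
    ∀ a < 3, ∀ b < 3, shading N (2 - a) (2 - b) = shading M a b

/-- `N` arises from `M` by a cyclic shift of the values or by a reversal of the values above the
first letter. -/
def BijectionStep (M N : ℕ) : Prop :=
  ((∀ a < 3, shading M a 2 = true) ∧
      ∀ a < 3, ∀ b < 3, shading N (2 - a) ((b + 1) % 3) = shading M a b) ∨
    ((∀ b < 3, shading M 0 b = true) ∧ (∀ a < 3, shading N a 0 = shading M a 0) ∧
      (∀ a < 3, shading N a 1 = shading M a 2) ∧ ∀ a < 3, shading N a 2 = shading M a 1)

/-- `N` arises from `M` by shading boxes that can be kept empty. -/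
def ShadeStep (M N : ℕ) : Prop :=
  (shading M 0 0 = false ∧ shading M 1 0 = false ∧
      (shading M 0 2 = true → shading M 1 2 = true) ∧
      (shading M 2 0 = true → shading M 2 1 = true) ∧ AddsBox 1 1 M N) ∨
    (shading M 1 1 = false ∧ shading M 0 1 = false ∧
      (shading M 1 2 = true → shading M 0 2 = true) ∧
      (shading M 2 1 = true → shading M 2 0 = true) ∧ AddsBox 0 0 M N) ∨
    (shading M 1 0 = false ∧ (shading M 1 1 = false ∨ shading M 0 0 = false) ∧
      (shading M 1 2 = true → shading M 0 2 = true) ∧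
      (shading M 2 0 = true → shading M 2 1 = true) ∧ AddsBox 0 1 M N) ∨
    -- 291 encodes the boxes `(0, 0)`, `(0, 1)`, `(1, 2)`, `(2, 2)`; 4 encodes `(0, 2)`; 151 encodes
    -- column 0 and row 1.
    (M = 0 ∧ ShadingLE N 291) ∨ (M = 4 ∧ ShadingLE 4 N ∧ ShadingLE N 151)

/-- A pair of shadings for which the avoiders were counted. -/
def CountStep (M N : ℕ) : Prop :=
  (M = 60 ∧ N = 27) ∨ (M = 60 ∧ N = 58) ∨ (M = 61 ∧ N = 59) ∨ (M = 62 ∧ N = 186)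

/-- One of the elementary Wilf-equivalences leads from `M` to `N`. -/
def Step (M N : ℕ) : Prop :=
  SymmetryStep M N ∨ BijectionStep M N ∨ ShadeStep M N ∨ CountStep M N

instance : DecidableRel ShadingLE := fun M N => by
  unfold ShadingLE
  infer_instance

instance (x y : ℕ) : DecidableRel (AddsBox x y) := fun M N => by
  unfold AddsBox
  infer_instance

instance : DecidableRel SymmetryStep := fun M N => by
  unfold SymmetryStep
  infer_instance

instance : DecidableRel BijectionStep := fun M N => by
  unfold BijectionStep
  infer_instance

instance : DecidableRel ShadeStep := fun M N => by
  unfold ShadeStep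
  infer_instance

instance : DecidableRel CountStep := fun M N => by
  unfold CountStep
  infer_instance

instance : DecidableRel Step := fun M N => by
  unfold Step
  infer_instance

theorem SameCount.symm {s t : ℕ → ℕ → Bool} (h : SameCount s t) : SameCount t s :=
  fun n => (h n).symm

theorem SameCount.trans {s t u : ℕ → ℕ → Bool} (h : SameCount s t) (h' : SameCount t u) :
    SameCount s u :=
  fun n => (h n).trans (h' n)

theorem ShadeStep.sameCount {M N : ℕ} (h : ShadeStep M N) :
    SameCount (shading M) (shading N) := by
  rcases h with ⟨h1, h2, h3, h4, h5, h6⟩ | ⟨h1, h2, h3, h4, h5, h6⟩ | ⟨h1, h2, h3, h4, h5, h6⟩ |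
    ⟨rfl, h1⟩ | ⟨rfl, h1, h2⟩
  · exact .of_contains (fun _ _ => .shade_one_one h1 h2 h3 h4 h6) (fun _ _ => .mono h5)
  · exact .of_contains (fun _ _ => .shade_zero_zero h1 h2 h3 h4 h6) (fun _ _ => .mono h5)
  · exact .of_contains (fun _ _ => .shade_zero_one h1 h2 h3 h4 h6) (fun _ _ => .mono h5)
  · exact .of_between (fun a _ b _ h => by simp [shading] at h) h1 fun _ _ => .shade_of_unshaded (by decide)
  · exact .of_between h1 h2 fun _ _ => .shade_of_zero_two (by decide) (by decide)

theorem Step.sameCount {M N : ℕ} (h : Step M N) : SameCount (shading M) (shading N) := by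
  rcases h with (h | h) | (⟨h1, h2⟩ | ⟨h1, h2, h3, h4⟩) | h | h
  · exact .transpose h
  · exact .rotate h
  · exact .shiftUp h1 h2
  · exact .swapRows h1 h2 h3 h4
  · exact h.sameCount
  · rcases h with ⟨rfl, rfl⟩ | ⟨rfl, rfl⟩ | ⟨rfl, rfl⟩ | ⟨rfl, rfl⟩
    · exact sameCount_60_27
    · exact sameCount_60_58
    · exact sameCount_61_59
    · exact sameCount_62_186

/-- The list of the values of `parent`, as the digits of a number in base `512`. -/
def parentTable : ℕ :=
  1398926404471143448560572510683561398456243741461095447735157668067845460590246854017665807968884495238107473691023075298818968059636912345225305922681547911638136002474545053791233610537098129711241674450808138115092160793924390546657131862208986465532533432195834116750353013495037689514824629726431091987040014854428922242888723858707917835282795550719042241457270269541950750331694585371467030322402571436224635440996400300250012444266190046458451358839674073581195039255014850674190541474358784968130489675739328252644158066737235292446619864728426782365091266538305376401732345497921990489706333721083452913579118015344913039401761395010851278339699955385862846397990056731480976303548201633910731416933220772615662439800136172622055307484293226641933446242080691339288078313606711809665238806746372998884472319265167060200498969200568126343891682716607133808742647160309065904892143258604708217840452745700588040666638422920670445884286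5813012533515898748850262594674053725087626240543146690892040807951252442437150608232466975296227952779501857399341375644815680849683087150126646804115778628057467480588957243870928395159311691690370450927661229591239777661910991901575822881640243105817754419527103877305442000020098723872442924290555359810687263863766072214612195286516444053362424778958698149425726217363943478364829918379335335752012471693904615225419128854333704708691066880

/-- A neighbour of `M` in the graph of the elementary Wilf-equivalences; the graph of this function
is a forest. -/
def parent (M : ℕ) : ℕ := parentTable / 512 ^ M % 512

/-- The roots of the forest. -/
def roots : Finset ℕ := (Finset.range 512).filter fun M => parent M = M

theorem card_roots : roots.card = 56 := by
  decide +kernel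

/-- Shading and counting steps are directed, while a forest edge may run against them. -/
theorem step_parent : ∀ M < 512, parent M = M ∨ Step M (parent M) ∨ Step (parent M) M := by
  decide +kernel

/-- Roots are fixed by `parent`, so one exponent that bounds all depths serves every vertex. -/
theorem iterate_parent_mem_roots : ∀ M < 512, parent^[11] M ∈ roots := by
  decide +kernel

theorem sameCount_parent {M : ℕ} (hM : M < 512) :
    SameCount (shading M) (shading (parent M)) := by
  rcases step_parent M hM with h | h | h
  · rw [h]
    exact fun _ => rfl
  · exact h.sameCount
  · exact h.sameCount.symm

theorem sameCount_iterate_parent {M : ℕ} (hM : M < 512) (k : ℕ) :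
    SameCount (shading M) (shading (parent^[k] M)) := by
  induction k generalizing M with
  | zero => exact fun _ => rfl
  | succ k ih => exact (sameCount_parent hM).trans (ih (Nat.mod_lt _ (by decide)))

/-! ### From mesh patterns to coded shadings -/

/-- Every shading is encoded by a number. -/
theorem exists_shading_eq (s : ℕ → ℕ → Bool) :
    ∃ M < 512, ∀ a < 3, ∀ b < 3, s a b = shading M a b := by
  refine ⟨Nat.ofBits fun k : Fin 9 => s (k / 3) (k % 3), Nat.ofBits_lt_two_pow _,
    fun a ha b hb => ?_⟩
  rw [shading, Nat.testBit_ofBits_lt _ _ (by omega)]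
  congr 1 <;> simp only <;> omega

/-- The shading by a set of boxes. -/
def shadingOf (R : Finset (Fin 3 × Fin 3)) (a b : ℕ) : Bool :=
  decide ((Fin.ofNat 3 a, Fin.ofNat 3 b) ∈ R)

theorem mem_iff_shadingOf {R : Finset (Fin 3 × Fin 3)} {a b : Fin 3} :
    (a, b) ∈ R ↔ shadingOf R a b = true := by
  simp [shadingOf]

/-- `InBox` is strict and excludes the chosen points, while `zone` assigns them to a strip; hence
the two inequations. -/
theorem inBox_one_iff {n : ℕ} {π : Perm (Fin n)} {c : Fin 2 → Fin n} (hc : c 0 < c 1)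
    (hπ : π (c 0) < π (c 1)) {a b : Fin 3} {m : Fin n} :
    InBox 1 π c a b m ↔ (m ≠ c 0 ∧ m ≠ c 1) ∧ zone (c 0) (c 1) m = a ∧
      zone (π (c 0)) (π (c 1)) (π m) = b := by
  have h0 := π.injective.ne_iff (x := m) (y := c 0)
  have h1 := π.injective.ne_iff (x := m) (y := c 1)
  have ha := a.isLt
  have hb := b.isLt
  simp only [InBox, Fin.forall_fin_two, Perm.one_def, Equiv.refl_symm, Equiv.refl_apply, Fin.val_zero, Fin.val_one]
  generalize a.val = a at *
  generalize b.val = b at *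
  generalize π (c 0) = u, π (c 1) = v, π m = w, c 0 = i, c 1 = j at *
  interval_cases a <;> interval_cases b <;> grind [zone]

theorem inBox_swap_iff {n : ℕ} {π : Perm (Fin n)} {c : Fin 2 → Fin n} (hc : c 0 < c 1)
    (hπ : π (c 1) < π (c 0)) {a b : Fin 3} {m : Fin n} :
    InBox (swap 0 1) π c a b m ↔ (m ≠ c 0 ∧ m ≠ c 1) ∧ zone (c 0) (c 1) m = a ∧
      zone (π (c 1)) (π (c 0)) (π m) = b := by
  have h0 := π.injective.ne_iff (x := m) (y := c 0)
  have h1 := π.injective.ne_iff (x := m) (y := c 1)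
  have ha := a.isLt
  have hb := b.isLt
  simp only [InBox, Fin.forall_fin_two, symm_swap, swap_apply_left, swap_apply_right, Fin.val_zero,
    Fin.val_one]
  generalize a.val = a at *
  generalize b.val = b at *
  generalize π (c 0) = u, π (c 1) = v, π m = w, c 0 = i, c 1 = j at *
  interval_cases a <;> interval_cases b <;> grind [zone]

theorem boxes_empty_iff {n : ℕ} {R : Finset (Fin 3 × Fin 3)} {i j u v : Fin n}
    {π : Perm (Fin n)} :
    (∀ a b, (a, b) ∈ R → ∀ m, ¬ ((m ≠ i ∧ m ≠ j) ∧ zone i j m = a ∧ zone u v (π m) = b)) ↔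
      ∀ m, m ≠ i → m ≠ j → shadingOf R (zone i j m) (zone u v (π m)) = false := by
  constructor
  · intro h m hi hj
    by_contra hR
    exact h ⟨_, zone_lt i j m⟩ ⟨_, zone_lt u v (π m)⟩ (mem_iff_shadingOf.2 (by simpa using hR)) m
      ⟨⟨hi, hj⟩, rfl, rfl⟩
  · rintro h a b hab m ⟨⟨hi, hj⟩, ha, hb⟩
    have := h m hi hj
    rw [ha, hb, mem_iff_shadingOf.1 hab] at this
    exact absurd this (by decide)

theorem strictMono_fin_two {n : ℕ} {c : Fin 2 → Fin n} : StrictMono c ↔ c 0 < c 1 := by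
  simp [Fin.strictMono_iff_lt_succ]

theorem isOccurrence_one_iff {n : ℕ} {R : Finset (Fin 3 × Fin 3)} {π : Perm (Fin n)}
    {c : Fin 2 → Fin n} :
    IsOccurrence (1, R) π c ↔ Occ (shadingOf R) π (c 0) (c 1) := by
  have h : (∀ i j : Fin 2, π (c i) < π (c j) ↔ (1 : Perm (Fin 2)) i < (1 : Perm (Fin 2)) j) ↔
      π (c 0) < π (c 1) := by
    simp only [Fin.forall_fin_two, Perm.one_apply]
    simpa using fun h => h.le
  simp only [IsOccurrence, Occ, strictMono_fin_two, h]
  refine and_congr_right fun hc => and_congr_right fun hπ => ?_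
  simp only [inBox_one_iff hc hπ]
  exact boxes_empty_iff

/-- Reversal of positions turns a descent into an ascent and reflects the columns. -/
theorem isOccurrence_swap_iff {n : ℕ} {R : Finset (Fin 3 × Fin 3)} {π : Perm (Fin n)}
    {c : Fin 2 → Fin n} :
    IsOccurrence (swap 0 1, R) π c ↔
      Occ (fun a b => shadingOf R (2 - a) b) (Fin.revPerm.trans π) (c 1).rev (c 0).rev := by
  have h : (∀ i j : Fin 2, π (c i) < π (c j) ↔ (swap 0 1 : Perm (Fin 2)) i < swap 0 1 j) ↔
      π (c 1) < π (c 0) := by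
    simp only [Fin.forall_fin_two, swap_apply_left, swap_apply_right]
    simpa using fun h => h.le
  simp only [IsOccurrence, Occ, strictMono_fin_two, h, Fin.rev_lt_rev, Equiv.trans_apply,
    Fin.revPerm_apply, Fin.rev_rev]
  refine and_congr_right fun hc => and_congr_right fun hπ => ?_
  simp only [inBox_swap_iff hc hπ]
  refine boxes_empty_iff.trans ⟨fun h m hj hi => ?_, fun h m hi hj => ?_⟩
  · obtain ⟨m, rfl⟩ := Fin.rev_surjective m
    have hi : m ≠ c 0 := fun e => hi (by rw [e])
    have hj : m ≠ c 1 := fun e => hj (by rw [e])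
    rw [zone_rev hi hj hc, Fin.rev_rev, Nat.sub_sub_self (Nat.le_of_lt_succ (zone_lt _ _ _))]
    exact h m hi hj
  · have := h m.rev (by simpa using hj) (by simpa using hi)
    rwa [zone_rev hi hj hc, Fin.rev_rev, Nat.sub_sub_self (Nat.le_of_lt_succ (zone_lt _ _ _))]
      at this

theorem ncard_avoiders_one (R : Finset (Fin 3 × Fin 3)) (n : ℕ) :
    (avoiders ((1, R) : MeshPattern 2) n).ncard = numAvoiding (shadingOf R) n := by
  rw [numAvoiding]
  congr 1
  ext π
  simp only [avoiders, Avoids, Set.mem_ofPred_eq, isOccurrence_one_iff]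
  exact not_congr ⟨fun ⟨c, h⟩ => ⟨_, _, h⟩, fun ⟨i, j, h⟩ => ⟨![i, j], h⟩⟩

theorem ncard_avoiders_swap (R : Finset (Fin 3 × Fin 3)) (n : ℕ) :
    (avoiders ((swap 0 1, R) : MeshPattern 2) n).ncard =
      numAvoiding (fun a b => shadingOf R (2 - a) b) n := by
  have h : ∀ π : Perm (Fin n), Avoids π ((swap 0 1, R) : MeshPattern 2) ↔
      ¬ Contains (fun a b => shadingOf R (2 - a) b) (Fin.revPerm.trans π) := by
    intro π
    simp only [Avoids, isOccurrence_swap_iff]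
    exact not_congr ⟨fun ⟨c, h⟩ => ⟨_, _, h⟩,
      fun ⟨i, j, h⟩ => ⟨![j.rev, i.rev], by simpa using h⟩⟩
  refine Set.ncard_congr (fun π _ => Fin.revPerm.trans π) (fun π hπ => (h π).1 hπ)
    (fun π σ _ _ he => ?_) (fun σ hσ => ⟨Fin.revPerm.trans σ, (h _).2 ?_, ?_⟩)
  · refine Equiv.ext fun x => ?_
    simpa using congr($he x.rev)
  · rwa [show Fin.revPerm.trans (Fin.revPerm.trans σ) = σ by ext; simp]
  · ext; simp

/-- Every pattern of length two is Wilf-equivalent to one of the roots. -/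
theorem exists_root (p : MeshPattern 2) :
    ∃ M ∈ roots, ∀ n, (avoiders p n).ncard = numAvoiding (shading M) n := by
  obtain ⟨τ, R⟩ := p
  obtain ⟨s, hs⟩ : ∃ s, ∀ n, (avoiders ((τ, R) : MeshPattern 2) n).ncard = numAvoiding s n := by
    have hτ : ∀ τ : Perm (Fin 2), τ = 1 ∨ τ = swap 0 1 := by decide
    rcases hτ τ with rfl | rfl
    · exact ⟨_, ncard_avoiders_one R⟩
    · exact ⟨_, ncard_avoiders_swap R⟩
  obtain ⟨M, hM, h⟩ := exists_shading_eq s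
  exact ⟨_, iterate_parent_mem_roots M hM, fun n =>
    (hs n).trans ((SameCount.congr h).trans (sameCount_iterate_parent hM 11) n)⟩

/-- A Wilf-class consists of all patterns that are Wilf-equivalent to one of its elements. -/
theorem IsWilfClass.exists_eq {k : ℕ} {A : Set (MeshPattern k)} (hA : IsWilfClass A) :
    ∃ p, A = {q | WilfEquiv p q} := by
  obtain ⟨p, hp⟩ : A.Nonempty := by
    rw [Set.nonempty_iff_ne_empty]
    rintro rfl
    -- The empty set is not maximal, as any singleton is a larger subclass.
    have h : IsWilfSubclass {((1, ∅) : MeshPattern k)} := by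
      rintro p rfl q rfl n
      rfl
    simpa using hA.2 h (Set.empty_subset _)
  have h : IsWilfSubclass {q | WilfEquiv p q} := fun q hq r hr n => (hq n).symm.trans (hr n)
  exact ⟨p, Set.Subset.antisymm (fun q hq => hA.1 p hp q hq) (hA.2 h fun q hq => hA.1 p hp q hq)⟩

end MeshPattern

theorem mainTheorem1 :
    Nat.card (MeshPattern 2) = 1024 ∧
      {A : Set (MeshPattern 2) | MeshPattern.IsWilfClass A}.encard ≤ 56 := by
  constructor
  · simp [MeshPattern, Nat.card_eq_fintype_card, Fintype.card_perm]
  -- Each Wilf-class is the set of patterns with the counts of some root, so the classes lie in an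
  -- image of `roots`.
  · have h : {A : Set (MeshPattern 2) | MeshPattern.IsWilfClass A} ⊆
        (fun M => {q : MeshPattern 2 | ∀ n, (MeshPattern.avoiders q n).ncard =
          MeshPattern.numAvoiding (MeshPattern.shading M) n}) '' MeshPattern.roots := by
      intro A hA
      obtain ⟨p, rfl⟩ := hA.exists_eq
      obtain ⟨M, hM, h⟩ := MeshPattern.exists_root p
      refine ⟨M, hM, ?_⟩
      ext q
      simp only [MeshPattern.WilfEquiv, Set.mem_ofPred_eq, h, eq_comm]
    refine (Set.encard_le_encard h).trans ((Set.encard_image_le _ _).trans ?_)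
    rw [Set.encard_coe_eq_coe_finsetCard, MeshPattern.card_roots]
    rfl
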